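/- Conventions. Let $\Gamma$ be a metric graph. $\mathrm{PL}(\Gamma)$ is the set of continuous piecewise linear functions on $\Gamma$ with integer slopes; $\mathrm{sl}_\eta(f)$ is the outgoing slope of $f$ along a tangent vector $\eta$; $\mathrm{div}(f)=\sum_{v}\bigl(-\sum_{\eta\in T_v(\Gamma)}\mathrm{sl}_\eta(f)\bigr)\cdot v$; and $R(D)=\{f\in\mathrm{PL}(\Gamma): D+\mathrm{div}(f)\ge 0\}$ for a divisor $D$. A tropical submodule is a set of functions closed under tropical linear combinations $\min_j\{f_j+a_j\}$, $a_j\in\mathbb R$. A finite set of functions $f_j$ is tropically dependent if, for some real $a_j$, the minimum of the $f_j+a_j$ is attained at least twice at every point of $\Gamma$. A tropical linear series of rank $r\ge 0$ is a pair $(D,\Sigma)$, with $D$ a divisor and $\Sigma\subseteq R(D)$ a finitely generated tropical submodule, such that (1) for every effective divisor $E$ of degree $r$ there is $f\in\Sigma$ with $\mathrm{div}(f)+D\ge E$, and (2) every set of $r+2$ functions in $\Sigma$ is tropically dependent. It is strongly recursive if moreover (recursively in $r$; subseries have the same $D$): (3) for $r\ge1$, every set of $r$ functions in $\Sigma$ is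 contained in a strongly recursive tropical linear subseries of rank $r-1$; and (4) if $S_1,S_2\subseteq\Sigma$ have sizes $s_1,s_2\le r$ with $s_1+s_2\ge r+2$, there are strongly recursive tropical linear subseries $\Sigma_1\supseteq S_1$ and $\Sigma_2\supseteq S_2$ of ranks $s_1-1$ and $s_2-1$ such that $\Sigma_1\cap\Sigma_2$ contains a strongly recursive tropical linear series of rank $s_1+s_2-r-2$. If $v$ has tangent vectors $\eta_1,\dots,\eta_d$ and, for each $i$, exactly $r+1$ slopes $s_{\eta_i}[0]<\dots<s_{\eta_i}[r]$ along $\eta_i$ occur among the functions of $\Sigma$, the local array of $\Sigma$ at $v$ is the set of $\mathbf x\in[r]^d$, where $[r]=\{0,\dots,r\}$, for which some $f\in\Sigma$ has $\mathrm{sl}_{\eta_i}(f)=s_{\eta_i}[x_i]$ for all $i$. Order $[r]^d$ coordinatewise, so that meets $\wedge$ are coordinatewise minima. A set $P\subseteq[r]^d$ is rankable of rank $s$ if for each $i$ exactly $s+1$ values occur as the $i$-th coordinate of elements of $P$. It is totally rankable if $\{\mathbf y\in P:\mathbf y\succeq\mathbf x\}$ is rankable for every $\mathbf x\in[r]^d$.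 A point $\mathbf x\in[r]^d$ is redundant if $\mathbf x=\bigwedge\mathcal H$ for some $\mathcal H\subseteq P$ with $|\mathcal H|\ge2$, each member of which has some coordinate in common with $\mathbf x$; $R(P)$ is the set of redundant points, and $\overline P=P\cup R(P)$ is the redundant closure of $P$. An $[r]^d$ permutation array is a totally rankable $P\subseteq[r]^d$ of rank $r$ with $P\cap R(P)=\emptyset$. An $[r]^d$ sparse permutation array is a $P\subseteq[r]^d$ such that for all $1\le i\le d$ and $n\in[r]$ exactly one $\mathbf x\in P$ has $x_i=n$. Proposition. Let $d\ge2$, $r\ge1$, $\ell>0$, and let $\Gamma$ be the star metric graph with central vertex $v$ and $d$ edges $e_1,\dots,e_d$ of length $\ell$. For every $[r]^d$ sparse permutation array $P$ there is a strongly recursive tropical linear series $(D,\Sigma)$ of rank $r$ on $\Gamma$ whose local array at $v$ (with the tangent vectors at $v$ in the order of the edges) is $\overline P$. In particular, for $d=2$ and every $r\ge0$, for every $[r]^2$ permutation array $P$ there is such a series on the star with two edges of length $\ell$. -/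

import Mathlib

open Filter Topology

/-! ### Metric graphs -/

/-- A metric graph, presented by a model: a finite graph (loops and multiple edges allowed)
together with a positive real length for each edge. Every edge carries a reference
orientation from `src` to `tgt`, used only to parametrize it by `[0, len e]`. -/
structure MetricGraph where
  V : Type
  E : Type
  finV : Finite V
  finE : Finite E
  src : E → V
  tgt : E → V
  len : E → ℝ
  len_pos : ∀ e, 0 < len e

namespace MetricGraph

variable (Γ : MetricGraph)

/-- A point of the metric graph is a vertex or an interior point of an edge. -/
abbrev Point : Type := Γ.V ⊕ (Σ e : Γ.E, Set.Ioo (0 : ℝ) (Γ.len e))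

variable {Γ}

open Classical in
/-- The parametrization `[0, len e] → Γ` of the edge `e` (constant outside that interval). -/
noncomputable def edgePt (e : Γ.E) (t : ℝ) : Γ.Point :=
  if h : t ∈ Set.Ioo (0 : ℝ) (Γ.len e) then .inr ⟨e, t, h⟩
  else if t ≤ 0 then .inl (Γ.src e) else .inl (Γ.tgt e)

/-- The outgoing tangent vectors at a point: at a vertex, the edges starting there together with
the edges ending there (a loop counts twice); at an interior point of an edge, the two directions
of the edge (`true` is the direction of the reference orientation). -/
def Tangent : Γ.Point → Type
  | .inl v => {e : Γ.E // Γ.src e = v} ⊕ {e : Γ.E // Γ.tgt e = v}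
  | .inr _ => Bool

theorem finite_tangent : ∀ p : Γ.Point, Finite (Tangent p)
  | .inl v => by
      have := Γ.finE
      exact inferInstanceAs
        (Finite ({e : Γ.E // Γ.src e = v} ⊕ {e : Γ.E // Γ.tgt e = v}))
  | .inr _ => inferInstanceAs (Finite Bool)

noncomputable instance (p : Γ.Point) : Fintype (Tangent p) :=
  @Fintype.ofFinite _ (finite_tangent p)

/-- The point at (small) distance `s` from `p` in the direction `η`. -/
noncomputable def ray : (p : Γ.Point) → Tangent p → ℝ → Γ.Point
  | .inl _, .inl e, s => edgePt e.1 s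
  | .inl _, .inr e, s => edgePt e.1 (Γ.len e.1 - s)
  | .inr q, true, s => edgePt q.1 (q.2.1 + s)
  | .inr q, false, s => edgePt q.1 (q.2.1 - s)

/-- Near `p`, the function `f` is affine along `η` with outgoing slope the integer `m`. -/
def HasSlope (f : Γ.Point → ℝ) (p : Γ.Point) (η : Tangent p) (m : ℤ) : Prop :=
  ∀ᶠ s in 𝓝[>] (0 : ℝ), f (ray p η s) = f p + m * s

/-- Slopes are unique. -/
theorem HasSlope.unique {f : Γ.Point → ℝ} {p : Γ.Point} {η : Tangent p} {m n : ℤ}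
    (hm : HasSlope f p η m) (hn : HasSlope f p η n) : m = n := by
  obtain ⟨s, ⟨h1, h2⟩, hs⟩ := ((hm.and hn).and self_mem_nhdsWithin).exists
  have hs' : (s : ℝ) ≠ 0 := ne_of_gt hs
  have h : (m : ℝ) * s = n * s := by linarith
  exact_mod_cast mul_right_cancel₀ hs' h

/-- `PL(Γ)`: continuous piecewise linear functions with integer slopes. By compactness of the
edges, it is equivalent to ask for an integer slope along every tangent vector of `Γ`
(continuity is included: `HasSlope` compares with the value of `f` at `p`). -/
def IsPL (f : Γ.Point → ℝ) : Prop :=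
  ∀ (p : Γ.Point) (η : Tangent p), ∃ m : ℤ, HasSlope f p η m

open Classical in
/-- The outgoing slope of `f` along the tangent vector `η` at `p`. -/
noncomputable def slope (f : Γ.Point → ℝ) (p : Γ.Point) (η : Tangent p) : ℤ :=
  if h : ∃ m : ℤ, HasSlope f p η m then h.choose else 0

theorem HasSlope.slope_eq {f : Γ.Point → ℝ} {p : Γ.Point} {η : Tangent p} {m : ℤ}
    (h : HasSlope f p η m) : slope f p η = m := by
  have h' : ∃ m : ℤ, HasSlope f p η m := ⟨m, h⟩
  rw [slope, dif_pos h']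
  exact h'.choose_spec.unique h

/-- The order of vanishing of `f` at `p`, i.e. the coefficient of `div f` at `p`. -/
noncomputable def ordAt (f : Γ.Point → ℝ) (p : Γ.Point) : ℤ :=
  - ∑ η : Tangent p, slope f p η

/-- Divisors on the metric graph. Effective divisors are those with `0 ≤ D`. -/
abbrev Divisor (Γ : MetricGraph) : Type := Γ.Point →₀ ℤ

/-- The degree of a divisor. -/
noncomputable def Divisor.deg (D : Divisor Γ) : ℤ := D.sum fun _ n => n

/-- The complete linear series `R(D)`. -/
def completeSeries (D : Divisor Γ) : Set (Γ.Point → ℝ) :=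
  {f | IsPL f ∧ ∀ p, 0 ≤ D p + ordAt f p}

/-! ### Tropical submodules and tropical dependence -/

/-- The tropical submodule generated by `S`: all `min_{f ∈ T} (f + a_f)` with `T ⊆ S` finite and
nonempty and real `a_f`. -/
def tropSpan (S : Set (Γ.Point → ℝ)) : Set (Γ.Point → ℝ) :=
  {θ | ∃ (T : Finset (Γ.Point → ℝ)) (hT : T.Nonempty) (a : (Γ.Point → ℝ) → ℝ),
    (T : Set (Γ.Point → ℝ)) ⊆ S ∧ ∀ p, θ p = T.inf' hT (fun f => f p + a f)}

/-- `L` is a finitely generated tropical submodule. -/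
def IsFGTropSubmodule (L : Set (Γ.Point → ℝ)) : Prop :=
  ∃ S : Finset (Γ.Point → ℝ), L = tropSpan (S : Set (Γ.Point → ℝ))

/-- A finite set of functions is tropically dependent: for some real `a_f`, at every point the
minimum of the `f + a_f` is attained by at least two members of the set. -/
def TropDependent (T : Finset (Γ.Point → ℝ)) : Prop :=
  ∃ a : (Γ.Point → ℝ) → ℝ, ∀ p, ∃ f ∈ T, ∃ g ∈ T, f ≠ g ∧
    f p + a f = g p + a g ∧ ∀ h ∈ T, f p + a f ≤ h p + a h

/-! ### Tropical linear series -/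

/-- `(D, L)` is a tropical linear series of rank `r`. -/
structure IsTropicalLinearSeries (D : Divisor Γ) (r : ℕ) (L : Set (Γ.Point → ℝ)) : Prop where
  fg : IsFGTropSubmodule L
  subset : L ⊆ completeSeries D
  exists_div_ge : ∀ E : Divisor Γ, 0 ≤ E → E.deg = r → ∃ f ∈ L, ∀ p, E p ≤ D p + ordAt f p
  dependent : ∀ T : Finset (Γ.Point → ℝ), (T : Set (Γ.Point → ℝ)) ⊆ L → T.card = r + 2 →
    TropDependent T

/-- `(D, L)` is a strongly recursive tropical linear series of rank `r` (recursively in `r`).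
For `r = 0` the second clause is void, and for `r ≤ 1` so is the third.
Subseries have the same divisor `D`. -/
def IsStronglyRecursive (D : Divisor Γ) (r : ℕ) (L : Set (Γ.Point → ℝ)) : Prop :=
  IsTropicalLinearSeries D r L ∧
  (∀ (_ : 1 ≤ r) (T : Finset (Γ.Point → ℝ)), (T : Set (Γ.Point → ℝ)) ⊆ L → T.card = r →
    ∃ L' ⊆ L, (T : Set (Γ.Point → ℝ)) ⊆ L' ∧ IsStronglyRecursive D (r - 1) L') ∧
  (∀ (s₁ s₂ : ℕ) (_ : s₁ ≤ r) (_ : s₂ ≤ r) (_ : r + 2 ≤ s₁ + s₂)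
    (S₁ S₂ : Finset (Γ.Point → ℝ)), (S₁ : Set (Γ.Point → ℝ)) ⊆ L →
    (S₂ : Set (Γ.Point → ℝ)) ⊆ L → S₁.card = s₁ → S₂.card = s₂ →
    ∃ L₁ ⊆ L, ∃ L₂ ⊆ L,
      (S₁ : Set (Γ.Point → ℝ)) ⊆ L₁ ∧ IsStronglyRecursive D (s₁ - 1) L₁ ∧
      (S₂ : Set (Γ.Point → ℝ)) ⊆ L₂ ∧ IsStronglyRecursive D (s₂ - 1) L₂ ∧
      ∃ L₃ ⊆ L₁ ∩ L₂, IsStronglyRecursive D (s₁ + s₂ - r - 2) L₃)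
termination_by r
decreasing_by all_goals omega

/-- `M ⊆ [r]^d` is the local array of `L` at the point `p`, whose tangent vectors are listed as
`η 0, …, η (d-1)`: there are exactly `r + 1` slopes `s i 0 < ⋯ < s i r` of functions of `L` along
each `η i`, and `x ∈ M` if and only if some `f ∈ L` has slope `s i (x i)` along `η i` for all `i`. -/
def IsLocalArray {d r : ℕ} (L : Set (Γ.Point → ℝ)) (p : Γ.Point) (η : Fin d ≃ Tangent p)
    (M : Set (Fin d → Fin (r + 1))) : Prop :=
  ∃ s : Fin d → Fin (r + 1) → ℤ,
    (∀ i, StrictMono (s i) ∧ Set.range (s i) = {m | ∃ f ∈ L, slope f p (η i) = m}) ∧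
    M = {x | ∃ f ∈ L, ∀ i, slope f p (η i) = s i (x i)}

/-- The star metric graph with `d` edges of length `ℓ` from the central vertex `none` to the
leaves `some i`. -/
def star (d : ℕ) (ℓ : ℝ) (hℓ : 0 < ℓ) : MetricGraph where
  V := Option (Fin d)
  E := Fin d
  finV := inferInstance
  finE := inferInstance
  src := fun _ => none
  tgt := fun i => some i
  len := fun _ => ℓ
  len_pos := fun _ => hℓ

/-- The central vertex of the star. -/
def starCenter (d : ℕ) (ℓ : ℝ) (hℓ : 0 < ℓ) : (star d ℓ hℓ).Point :=
  Sum.inl (none : Option (Fin d))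

/-- The tangent vectors at the center of the star, in the order of the edges. -/
def starTangent (d : ℕ) (ℓ : ℝ) (hℓ : 0 < ℓ) : Fin d ≃ Tangent (starCenter d ℓ hℓ) where
  toFun i := Sum.inl ⟨i, rfl⟩
  invFun η := match η with
    | Sum.inl e => e.1
    | Sum.inr e => absurd e.2 (Option.some_ne_none e.1)
  left_inv _ := rfl
  right_inv η := match η with
    | Sum.inl _ => rfl
    | Sum.inr e => absurd e.2 (Option.some_ne_none e.1)

end MetricGraph

/-! ### Permutation arrays

Dot arrays in `[r]^d`, where `[r] = {0, …, r}`, are subsets of `Fin d → Fin (r + 1)`. -/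

namespace DotArray

/-- The rank of `P` along the `i`-axis: the number of values of the `i`-th coordinate on `P`,
minus one. -/
noncomputable def rankAlong {d r : ℕ} (P : Set (Fin d → Fin (r + 1))) (i : Fin d) : ℤ :=
  (Set.ncard ((fun x => x i) '' P) : ℤ) - 1

/-- `P` is rankable of rank `s`. -/
def HasRank {d r : ℕ} (P : Set (Fin d → Fin (r + 1))) (s : ℤ) : Prop :=
  ∀ i, rankAlong P i = s

/-- The principal subarray of `P` at `x`. -/
def principal {d r : ℕ} (P : Set (Fin d → Fin (r + 1))) (x : Fin d → Fin (r + 1)) :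
    Set (Fin d → Fin (r + 1)) :=
  {y ∈ P | x ≤ y}

/-- Every principal subarray is rankable. -/
def IsTotallyRankable {d r : ℕ} (P : Set (Fin d → Fin (r + 1))) : Prop :=
  ∀ x, ∃ s : ℤ, HasRank (principal P x) s

/-- The set `R(P)` of redundant positions: meets (coordinatewise minima) of subsets `H ⊆ P` with
at least two elements, all of which share some coordinate with the meet. -/
def redundant {d r : ℕ} (P : Set (Fin d → Fin (r + 1))) : Set (Fin d → Fin (r + 1)) :=
  {x | ∃ H : Finset (Fin d → Fin (r + 1)), (H : Set (Fin d → Fin (r + 1))) ⊆ P ∧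
    2 ≤ H.card ∧ H.inf id = x ∧ ∀ y ∈ H, ∃ i, y i = x i}

/-- The redundant closure of `P`. -/
def redundantClosure {d r : ℕ} (P : Set (Fin d → Fin (r + 1))) : Set (Fin d → Fin (r + 1)) :=
  P ∪ redundant P

/-- `P` is an `[r]^d` permutation array (rank `r`, dimension `d`). -/
structure IsPermutationArray {d r : ℕ} (P : Set (Fin d → Fin (r + 1))) : Prop where
  totallyRankable : IsTotallyRankable P
  rank_eq : HasRank P r
  not_redundant : Disjoint P (redundant P)

/-- `P` is an `[r]^d` sparse permutation array: every `[r]^(d-1)`-subarray, i.e. every slice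
`x i = n`, contains exactly one dot. (Such a `P` is automatically a permutation array.) -/
def IsSparsePermutationArray {d r : ℕ} (P : Set (Fin d → Fin (r + 1))) : Prop :=
  ∀ (i : Fin d) (n : Fin (r + 1)), ∃! x, x ∈ P ∧ x i = n

end DotArray

/-! ### Tropical combinations -/

/-! Each dot x of the sparse array P defines a function f_x on the star that vanishes at the center
and has constant slope x_i along e_i; there are r + 1 dots. Let K be the field of Hahn series in t
with real exponents and rational coefficients. A subspace W of K^P yields the set of functions min_x
(f_x + val w_x) for nonzero w in W, and Σ is the set given by W = K^P. The key fact is that every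
subspace of dimension n + 1 ≤ r + 1 gives a tropical linear series of rank n
(`isTropicalLinearSeries_star`). The recursive conditions then become linear algebra: lift functions
to vectors, enlarge their span inside W, and use the dimension formula for intersections
(`isStronglyRecursive_tropSeries`).

Finite generation comes from vectors of minimal support, unique up to scalar for a given support.
Dependence of n + 2 functions comes from a linear relation among lifts, whose leading terms must
cancel. For an effective E of degree n, impose on w the equations ∑_x w_x t^{f_x(p)} y^{n_x} = 0 for
y = 1, …, E(p), where n_x is the slope of f_x on the edge of p. These are only n linear conditions,
so W contains a nonzero solution. Away from the center, the leading coefficients at p form a nonzero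
polynomial with E(p) distinct nonzero roots, so its largest and smallest exponents differ by at
least E(p). Since P is sparse the n_x are distinct, so these exponents are slopes of terms attaining
the minimum at p, and their difference bounds the order there from below. The center takes care of
itself: D is concentrated there with coefficient dr + r.

All f_x vanish at the center, so any nonempty subset of P can be the set of terms attaining the
minimum there, and the slopes are then the coordinates of its meet. Such meets form exactly the
redundant closure. For d = 2 the second claim follows because permutation arrays are sparse
(`IsPermutationArray.isSparse`). -/

/-- `θ` is the tropical linear combination `min_j (f j + c j)`; terms with `c j = ⊤` are absent. -/
def IsTropComb {X ι : Type*} (f : ι → X → ℝ) (c : ι → WithTop ℝ) (θ : X → ℝ) : Prop :=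
  ∀ p, (∀ j, (θ p : WithTop ℝ) ≤ f j p + c j) ∧ ∃ j, (θ p : WithTop ℝ) = f j p + c j

namespace IsTropComb

variable {X ι : Type*} {f : ι → X → ℝ} {c c' : ι → WithTop ℝ} {θ θ' : X → ℝ}

theorem congr_coeff (h : IsTropComb f c θ) (hc : ∀ j, c j = c' j) : IsTropComb f c' θ := by
  rwa [← (funext hc : c = c')]

theorem unique (h : IsTropComb f c θ) (h' : IsTropComb f c θ') : θ = θ' := by
  funext p
  obtain ⟨j, hj⟩ := (h p).2
  obtain ⟨k, hk⟩ := (h' p).2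
  have h1 := (h p).1 k
  have h2 := (h' p).1 j
  rw [← hk] at h1
  rw [← hj] at h2
  exact le_antisymm (WithTop.coe_le_coe.1 h1) (WithTop.coe_le_coe.1 h2)

theorem min (h : IsTropComb f c θ) (h' : IsTropComb f c' θ') :
    IsTropComb f (fun j => Min.min (c j) (c' j)) (fun p => Min.min (θ p) (θ' p)) := by
  intro p
  refine ⟨fun j => ?_, ?_⟩
  · rw [← min_add_add_left, WithTop.coe_min]
    exact min_le_min ((h p).1 j) ((h' p).1 j)
  · rcases le_total (θ p) (θ' p) with hle | hle
    · obtain ⟨j, hj⟩ := (h p).2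
      refine ⟨j, ?_⟩
      beta_reduce
      rw [min_eq_left hle, ← min_add_add_left, ← hj, min_eq_left]
      exact (WithTop.coe_le_coe.2 hle).trans ((h' p).1 j)
    · obtain ⟨j, hj⟩ := (h' p).2
      refine ⟨j, ?_⟩
      beta_reduce
      rw [min_eq_right hle, ← min_add_add_left, ← hj, min_eq_right]
      exact (WithTop.coe_le_coe.2 hle).trans ((h p).1 j)

theorem add_const (h : IsTropComb f c θ) (a : ℝ) :
    IsTropComb f (fun j => c j + a) (fun p => θ p + a) := by
  intro p
  refine ⟨fun j => ?_, ?_⟩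
  · rw [← add_assoc, WithTop.coe_add]
    gcongr
    exact (h p).1 j
  · obtain ⟨j, hj⟩ := (h p).2
    exact ⟨j, by rw [← add_assoc, WithTop.coe_add, hj]⟩

theorem exists_coeff_ne_top [Nonempty X] (h : IsTropComb f c θ) : ∃ j, c j ≠ ⊤ := by
  obtain ⟨p⟩ := ‹Nonempty X›
  obtain ⟨j, hj⟩ := (h p).2
  refine ⟨j, fun hc => ?_⟩
  rw [hc, add_top] at hj
  exact WithTop.coe_ne_top hj

theorem exists_of_ne_top [Fintype ι] (f : ι → X → ℝ) {j : ι} (hc : c j ≠ ⊤) :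
    ∃ θ, IsTropComb f c θ := by
  have key : ∀ p, ∃ t : ℝ, (∀ k, (t : WithTop ℝ) ≤ f k p + c k) ∧
      ∃ k, (t : WithTop ℝ) = f k p + c k := by
    intro p
    obtain ⟨k, -, hk⟩ := Finset.exists_min_image Finset.univ
      (fun k => (f k p : WithTop ℝ) + c k) ⟨j, Finset.mem_univ j⟩
    have hne : (f k p : WithTop ℝ) + c k ≠ ⊤ := by
      refine ((hk j (Finset.mem_univ j)).trans_lt ?_).ne
      exact WithTop.add_lt_top.2 ⟨WithTop.coe_lt_top _, lt_top_iff_ne_top.2 hc⟩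
    obtain ⟨t, ht⟩ := WithTop.ne_top_iff_exists.1 hne
    exact ⟨t, fun l => ht ▸ hk l (Finset.mem_univ l), k, ht⟩
  choose θ hθ using key
  exact ⟨θ, hθ⟩

theorem exists_bound [Fintype ι] (h : IsTropComb f c θ) {B : ℝ}
    (hf : ∀ j p, |f j p| ≤ B) : ∃ B', ∀ p, |θ p| ≤ B' := by
  refine ⟨B + ∑ j, |(c j).untopD 0|, fun p => ?_⟩
  obtain ⟨j, hj⟩ := (h p).2
  have hc : c j ≠ ⊤ := by
    intro hc
    rw [hc, add_top] at hj
    exact WithTop.coe_ne_top hj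
  obtain ⟨t, ht⟩ := WithTop.ne_top_iff_exists.1 hc
  rw [← ht, ← WithTop.coe_add, WithTop.coe_inj] at hj
  have h1 : |(c j).untopD 0| ≤ ∑ j, |(c j).untopD 0| :=
    Finset.single_le_sum (f := fun j => |(c j).untopD 0|) (fun _ _ => abs_nonneg _)
      (Finset.mem_univ j)
  rw [← ht, WithTop.untopD_coe] at h1
  rw [hj]
  exact (abs_add_le _ _).trans (add_le_add (hf j p) h1)

/-- The generators themselves are tropical combinations. -/
theorem single [DecidableEq ι] (f : ι → X → ℝ) (j : ι) (a : ℝ) :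
    IsTropComb f (fun k => if k = j then (a : WithTop ℝ) else ⊤) (fun p => f j p + a) := by
  intro p
  refine ⟨fun k => ?_, j, by simp⟩
  by_cases hk : k = j
  · simp [hk]
  · simp [hk]

end IsTropComb

/-! ### Tropical spans with coefficients allowed to be infinite -/

namespace MetricGraph

variable {Γ : MetricGraph}

theorem mem_tropSpan_iff [Nonempty Γ.Point] (S : Finset (Γ.Point → ℝ)) (θ : Γ.Point → ℝ) :
    θ ∈ tropSpan (S : Set (Γ.Point → ℝ)) ↔
      ∃ c : S → WithTop ℝ, IsTropComb (fun s : S => s.1) c θ := by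
  classical
  constructor
  · rintro ⟨T, hT, a, hTS, hθ⟩
    refine ⟨fun s => if s.1 ∈ T then (a s.1 : WithTop ℝ) else ⊤, fun p => ⟨fun s => ?_, ?_⟩⟩
    · by_cases hs : s.1 ∈ T
      · simp only [hs, if_true]
        rw [← WithTop.coe_add, WithTop.coe_le_coe, hθ p]
        exact Finset.inf'_le (fun f => f p + a f) hs
      · simp [hs]
    · obtain ⟨g, hg, hgp⟩ := Finset.exists_mem_eq_inf' hT (fun f => f p + a f)
      refine ⟨⟨g, hTS hg⟩, ?_⟩
      simp only [hg, if_true]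
      rw [hθ p, hgp, WithTop.coe_add]
  · rintro ⟨c, hc⟩
    let T : Finset (Γ.Point → ℝ) := (Finset.univ.filter (fun s : S => c s ≠ ⊤)).image Subtype.val
    have hTS : ∀ g ∈ T, ∃ h : g ∈ S, c ⟨g, h⟩ ≠ ⊤ := by
      intro g hg
      obtain ⟨s, hs, rfl⟩ := Finset.mem_image.1 hg
      exact ⟨s.2, (Finset.mem_filter.1 hs).2⟩
    have hT : T.Nonempty := by
      obtain ⟨s, hs⟩ := hc.exists_coeff_ne_top
      exact ⟨s.1, Finset.mem_image_of_mem _ (by simpa using hs)⟩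
    let a : (Γ.Point → ℝ) → ℝ := fun g => if h : g ∈ S then (c ⟨g, h⟩).untopD 0 else 0
    have ha : ∀ s : S, c s ≠ ⊤ → ((a s.1 : ℝ) : WithTop ℝ) = c s := by
      intro s hs
      obtain ⟨t, ht⟩ := WithTop.ne_top_iff_exists.1 hs
      simp [a, ← ht]
    refine ⟨T, hT, a, fun g hg => (hTS g hg).1, fun p => le_antisymm ?_ ?_⟩
    · refine Finset.le_inf' hT _ fun g hg => ?_
      obtain ⟨hgS, hgc⟩ := hTS g hg
      have := (hc p).1 ⟨g, hgS⟩
      rwa [← ha _ hgc, ← WithTop.coe_add, WithTop.coe_le_coe] at this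
    · obtain ⟨s, hs⟩ := (hc p).2
      have hsc : c s ≠ ⊤ := by
        intro h
        rw [h, add_top] at hs
        exact WithTop.coe_ne_top hs
      have hsT : s.1 ∈ T := Finset.mem_image_of_mem _ (by simpa using hsc)
      rw [← ha _ hsc, ← WithTop.coe_add, WithTop.coe_inj] at hs
      rw [hs]
      exact Finset.inf'_le (fun f => f p + a f) hsT

end MetricGraph

/-! ### Tropicalizations of vector spaces over Hahn series -/

open HahnSeries

/-- Leading terms can cancel only if the two orders agree, and then only for the one excluded value
of α. -/
theorem HahnSeries.orderTop_add_single_zero_mul {u w : HahnSeries ℝ ℚ} {α : ℚ} (hα : α ≠ 0)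
    (h : α ≠ -u.leadingCoeff / w.leadingCoeff) :
    (u + single 0 α * w).orderTop = min u.orderTop w.orderTop := by
  have hw : (single (0 : ℝ) α * w).orderTop = w.orderTop := by
    rw [orderTop_mul, orderTop_single hα, WithTop.coe_zero, zero_add]
  rcases lt_trichotomy u.orderTop w.orderTop with hlt | heq | hlt
  · rw [min_eq_left hlt.le, orderTop_add_eq_left (by rwa [hw])]
  · by_cases hw0 : w = 0
    · have hu0 : u = 0 := by rw [← orderTop_eq_top, heq, hw0, orderTop_zero]
      simp [hw0, hu0]
    · have hu0 : u ≠ 0 := by rwa [← orderTop_ne_top, heq, orderTop_ne_top]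
      refine le_antisymm ?_ ?_
      · rw [heq, min_self, ← order_eq_orderTop_of_ne_zero hw0]
        refine orderTop_le_of_coeff_ne_zero ?_
        have ho : u.order = w.order := by
          rw [← WithTop.coe_inj, order_eq_orderTop_of_ne_zero hu0,
            order_eq_orderTop_of_ne_zero hw0, heq]
        rw [coeff_add, coeff_single_zero_mul, ← ho, ← leadingCoeff_eq, ho, ← leadingCoeff_eq]
        intro h0
        apply h
        rw [eq_div_iff (leadingCoeff_ne_zero.2 hw0)]
        linarith
      · conv_lhs => rw [← hw]
        exact min_orderTop_le_orderTop_add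
  · rw [min_eq_right hlt.le, orderTop_add_eq_right (by rwa [hw]), hw]

/-- The functions `min_j (f j + val (w j))` for `w` in a space `W` of vectors of Hahn series. -/
def tropSeries {X ι : Type*} (f : ι → X → ℝ) (W : Submodule (HahnSeries ℝ ℚ) (ι → HahnSeries ℝ ℚ)) :
    Set (X → ℝ) :=
  {θ | ∃ w ∈ W, IsTropComb f (fun j => (w j).orderTop) θ}

section tropSeries

variable {X ι : Type*} {f : ι → X → ℝ}
  {W : Submodule (HahnSeries ℝ ℚ) (ι → HahnSeries ℝ ℚ)} {θ θ' : X → ℝ}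

theorem tropSeries_mono {W' : Submodule (HahnSeries ℝ ℚ) (ι → HahnSeries ℝ ℚ)} (h : W ≤ W') :
    tropSeries f W ⊆ tropSeries f W' :=
  fun _ ⟨w, hw, hθ⟩ => ⟨w, h hw, hθ⟩

theorem add_const_mem_tropSeries (h : θ ∈ tropSeries f W) (a : ℝ) :
    (fun p => θ p + a) ∈ tropSeries f W := by
  obtain ⟨w, hw, hθ⟩ := h
  refine ⟨single a (1 : ℚ) • w, W.smul_mem _ hw, (hθ.add_const a).congr_coeff fun j => ?_⟩
  rw [Pi.smul_apply, smul_eq_mul, orderTop_mul, orderTop_single one_ne_zero, add_comm]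

theorem min_mem_tropSeries [Fintype ι] (h : θ ∈ tropSeries f W) (h' : θ' ∈ tropSeries f W) :
    (fun p => min (θ p) (θ' p)) ∈ tropSeries f W := by
  classical
  obtain ⟨u, hu, hθ⟩ := h
  obtain ⟨w, hw, hθ'⟩ := h'
  -- A generic scalar: each coordinate excludes one value and ℚ is infinite, so one α avoids
  -- cancellation in all coordinates.
  obtain ⟨α, hα⟩ := Infinite.exists_notMem_finset
    (insert 0 (Finset.univ.image fun j => -(u j).leadingCoeff / (w j).leadingCoeff))
  simp only [Finset.mem_insert, Finset.mem_image, Finset.mem_univ, true_and, not_or,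
    not_exists] at hα
  refine ⟨u + single (0 : ℝ) α • w, W.add_mem hu (W.smul_mem _ hw),
    (hθ.min hθ').congr_coeff fun j => ?_⟩
  rw [Pi.add_apply, Pi.smul_apply, smul_eq_mul,
    orderTop_add_single_zero_mul hα.1 (Ne.symm (hα.2 j))]

end tropSeries

/-! ### Vectors of minimal support in a subspace -/

section Circuits

variable {ι : Type*} [Fintype ι] {W : Submodule (HahnSeries ℝ ℚ) (ι → HahnSeries ℝ ℚ)}

open Classical in
/-- The support of a vector of Hahn series. -/
noncomputable def vecSupport (w : ι → HahnSeries ℝ ℚ) : Finset ι :=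
  Finset.univ.filter fun j => w j ≠ 0

theorem mem_vecSupport {w : ι → HahnSeries ℝ ℚ} {j : ι} : j ∈ vecSupport w ↔ w j ≠ 0 := by
  simp [vecSupport]

theorem vecSupport_nonempty {w : ι → HahnSeries ℝ ℚ} (hw : w ≠ 0) : (vecSupport w).Nonempty := by
  obtain ⟨j, hj⟩ := Function.ne_iff.1 hw
  exact ⟨j, mem_vecSupport.2 hj⟩

/-- A circuit of `W` is a nonzero vector of `W` of minimal support. -/
def IsCircuit (W : Submodule (HahnSeries ℝ ℚ) (ι → HahnSeries ℝ ℚ)) (w : ι → HahnSeries ℝ ℚ) :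
    Prop :=
  w ∈ W ∧ w ≠ 0 ∧ ∀ u ∈ W, u ≠ 0 → vecSupport u ⊆ vecSupport w → vecSupport u = vecSupport w

/-- Subtracting the multiple of u that kills one coordinate of w leaves strictly smaller support, so
by minimality nothing is left. -/
theorem IsCircuit.eq_smul {u w : ι → HahnSeries ℝ ℚ} (hw : IsCircuit W w) (hu : IsCircuit W u)
    (h : vecSupport u = vecSupport w) : ∃ a : HahnSeries ℝ ℚ, a ≠ 0 ∧ w = a • u := by
  obtain ⟨i, hi⟩ := vecSupport_nonempty hw.2.1
  have hwi : w i ≠ 0 := mem_vecSupport.1 hi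
  have hui : u i ≠ 0 := mem_vecSupport.1 (h ▸ hi)
  refine ⟨w i / u i, div_ne_zero hwi hui, ?_⟩
  by_contra hne
  have hsub : w - (w i / u i) • u ≠ 0 := sub_ne_zero.2 hne
  have hz : (w - (w i / u i) • u) i = 0 := by
    simp [div_mul_cancel₀ _ hui]
  have hs := hw.2.2 _ (W.sub_mem hw.1 (W.smul_mem _ hu.1)) hsub (fun j hj => by
    by_contra hjw
    have h1 : w j = 0 := by simpa [mem_vecSupport] using hjw
    have h2 : u j = 0 := by
      rw [← h] at hjw
      simpa [mem_vecSupport] using hjw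
    exact mem_vecSupport.1 hj (by simp [h1, h2]))
  rw [← hs] at hi
  exact mem_vecSupport.1 hi hz

/-- A vector that is not a circuit is, valuatively, the minimum of two vectors of `W` of smaller
support. -/
theorem exists_decomp_of_not_isCircuit {w : ι → HahnSeries ℝ ℚ} (hw : w ∈ W) (hw0 : w ≠ 0)
    (hc : ¬ IsCircuit W w) :
    ∃ u ∈ W, ∃ u' ∈ W, u ≠ 0 ∧ u' ≠ 0 ∧ vecSupport u ⊂ vecSupport w ∧
      vecSupport u' ⊂ vecSupport w ∧
      ∀ j, (w j).orderTop = min (u j).orderTop (u' j).orderTop := by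
  obtain ⟨u, huW, hu0, hsub, hne⟩ : ∃ u ∈ W, u ≠ 0 ∧ vecSupport u ⊆ vecSupport w ∧
      vecSupport u ≠ vecSupport w := by
    by_contra hcon
    push Not at hcon
    exact hc ⟨hw, hw0, hcon⟩
  have hss : vecSupport u ⊂ vecSupport w := lt_of_le_of_ne hsub hne
  -- Maximality of this difference makes a • u, with a = w i / u i, have order at least that of w in
  -- every coordinate. Hence so does w - a • u, and since the two add up to w the minimum of their
  -- orders is exact.
  obtain ⟨i, hi, hmax⟩ := Finset.exists_max_image (vecSupport u)
    (fun i => (w i).order - (u i).order) (vecSupport_nonempty hu0)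
  have hui : u i ≠ 0 := mem_vecSupport.1 hi
  have hwi : w i ≠ 0 := mem_vecSupport.1 (hsub hi)
  have ha : w i / u i ≠ 0 := div_ne_zero hwi hui
  have hle : ∀ k, (w k).orderTop ≤ (((w i / u i) • u) k).orderTop := by
    intro k
    by_cases huk : u k = 0
    · simp [huk]
    have hwk : w k ≠ 0 := mem_vecSupport.1 (hsub (mem_vecSupport.2 huk))
    have h1 := hmax k (mem_vecSupport.2 huk)
    have h2 : (w i).order = (w i / u i).order + (u i).order := by
      rw [← order_mul ha hui, div_mul_cancel₀ _ hui]
    rw [Pi.smul_apply, smul_eq_mul, ← order_eq_orderTop_of_ne_zero hwk,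
      ← order_eq_orderTop_of_ne_zero (mul_ne_zero ha huk), order_mul ha huk, WithTop.coe_le_coe]
    linarith
  have hsupp : vecSupport ((w i / u i) • u) = vecSupport u := by
    ext k
    simp [mem_vecSupport, hwi, hui]
  obtain ⟨k, hkw, hku⟩ := Finset.exists_of_ssubset hss
  have hwk : w k ≠ 0 := mem_vecSupport.1 hkw
  have huk : u k = 0 := by simpa [mem_vecSupport] using hku
  refine ⟨w - (w i / u i) • u, W.sub_mem hw (W.smul_mem _ huW), (w i / u i) • u,
    W.smul_mem _ huW, ?_, smul_ne_zero ha hu0, ?_, hsupp ▸ hss, fun j => ?_⟩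
  · intro h
    have := congrFun h k
    simp [huk, hwk] at this
  · refine (Finset.ssubset_iff_of_subset fun j hj => ?_).2 ⟨i, hsub hi, ?_⟩
    · by_contra hjw
      have h1 : w j = 0 := by simpa [mem_vecSupport] using hjw
      have h2 : u j = 0 := by
        by_contra h2
        exact hjw (hsub (mem_vecSupport.2 h2))
      exact mem_vecSupport.1 hj (by simp [h1, h2])
    · simp [mem_vecSupport, div_mul_cancel₀ _ hui]
  · refine le_antisymm (le_min ?_ (hle j)) ?_
    · rw [Pi.sub_apply]
      exact (le_min le_rfl (hle j)).trans min_orderTop_le_orderTop_sub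
    · have := min_orderTop_le_orderTop_add (x := (w - (w i / u i) • u) j)
        (y := ((w i / u i) • u) j)
      rwa [← Pi.add_apply, sub_add_cancel] at this

end Circuits

/-! ### Finite generation and tropical dependence from linear algebra -/

namespace MetricGraph

variable {Γ : MetricGraph} {ι : Type*} [Fintype ι] {f : ι → Γ.Point → ℝ}
  {W : Submodule (HahnSeries ℝ ℚ) (ι → HahnSeries ℝ ℚ)}

theorem tropSpan_subset_tropSeries {S : Set (Γ.Point → ℝ)} (hS : S ⊆ tropSeries f W) :
    tropSpan S ⊆ tropSeries f W := by
  rintro θ ⟨T, hT, a, hTS, hθ⟩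
  have h : θ = T.inf' hT (fun g p => g p + a g) := by
    funext p
    rw [Finset.inf'_apply, hθ p]
  rw [h]
  refine Finset.inf'_induction hT _ (fun g hg g' hg' => min_mem_tropSeries hg hg')
    fun g hg => add_const_mem_tropSeries (hS (hTS hg)) _

/-- One function for each circuit support suffices: circuits with equal support are proportional,
and a scalar shifts the function by a constant. Other vectors split into minima of smaller support,
so induction on the support size applies. -/
theorem isFGTropSubmodule_tropSeries [Nonempty Γ.Point] :
    IsFGTropSubmodule (tropSeries f W) := by
  classical
  have hch : ∀ s : Finset ι, ∃ g : Γ.Point → ℝ, (∃ w, IsCircuit W w ∧ vecSupport w = s) →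
      ∃ w, IsCircuit W w ∧ vecSupport w = s ∧ IsTropComb f (fun j => (w j).orderTop) g := by
    intro s
    by_cases h : ∃ w, IsCircuit W w ∧ vecSupport w = s
    · obtain ⟨w, hw, hws⟩ := h
      obtain ⟨j, hj⟩ := Function.ne_iff.1 hw.2.1
      obtain ⟨g, hg⟩ := IsTropComb.exists_of_ne_top (c := fun j => (w j).orderTop) f
        (j := j) (orderTop_ne_top.2 hj)
      exact ⟨g, fun _ => ⟨w, hw, hws, hg⟩⟩
    · exact ⟨0, fun h' => absurd h' h⟩
  choose G hG using hch
  let S : Finset (Γ.Point → ℝ) :=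
    (Finset.univ.filter fun s => ∃ w, IsCircuit W w ∧ vecSupport w = s).image G
  have hS : (S : Set (Γ.Point → ℝ)) ⊆ tropSeries f W := by
    intro g hg
    obtain ⟨s, hs, rfl⟩ := Finset.mem_image.1 (Finset.mem_coe.1 hg)
    obtain ⟨w, hw, -, hg⟩ := hG s (Finset.mem_filter.1 hs).2
    exact ⟨w, hw.1, hg⟩
  refine ⟨S, Set.Subset.antisymm ?_ (tropSpan_subset_tropSeries hS)⟩
  have key : ∀ (n : ℕ) (w : ι → HahnSeries ℝ ℚ), (vecSupport w).card = n → w ∈ W → w ≠ 0 →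
      ∀ θ, IsTropComb f (fun j => (w j).orderTop) θ →
        ∃ c : S → WithTop ℝ, IsTropComb (fun s : S => s.1) c θ := by
    intro n
    induction n using Nat.strong_induction_on with
    | _ n ih =>
      intro w hn hw hw0 θ hθ
      by_cases hc : IsCircuit W w
      · obtain ⟨u, hu, hus, hg⟩ := hG _ ⟨w, hc, rfl⟩
        obtain ⟨a, ha, hwa⟩ := hc.eq_smul hu hus
        have hgS : G (vecSupport w) ∈ S :=
          Finset.mem_image_of_mem _ (Finset.mem_filter.2 ⟨Finset.mem_univ _, w, hc, rfl⟩)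
        have h1 : IsTropComb f (fun j => (w j).orderTop)
            (fun p => G (vecSupport w) p + a.order) := by
          refine (hg.add_const a.order).congr_coeff fun j => ?_
          rw [hwa, Pi.smul_apply, smul_eq_mul, orderTop_mul, order_eq_orderTop_of_ne_zero ha,
            add_comm]
        rw [hθ.unique h1]
        exact ⟨_, IsTropComb.single (fun s : S => s.1) ⟨_, hgS⟩ a.order⟩
      · obtain ⟨u, hu, u', hu', hu0, hu0', hs, hs', ho⟩ := exists_decomp_of_not_isCircuit hw hw0 hc
        obtain ⟨j, hj⟩ := Function.ne_iff.1 hu0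
        obtain ⟨j', hj'⟩ := Function.ne_iff.1 hu0'
        obtain ⟨g, hg⟩ := IsTropComb.exists_of_ne_top (c := fun j => (u j).orderTop) f
          (j := j) (orderTop_ne_top.2 hj)
        obtain ⟨g', hg'⟩ := IsTropComb.exists_of_ne_top (c := fun j => (u' j).orderTop) f
          (j := j') (orderTop_ne_top.2 hj')
        obtain ⟨c, hc⟩ := ih _ (hn ▸ Finset.card_lt_card hs) u rfl hu hu0 g hg
        obtain ⟨c', hc'⟩ := ih _ (hn ▸ Finset.card_lt_card hs') u' rfl hu' hu0' g' hg'
        rw [hθ.unique ((hg.min hg').congr_coeff fun j => (ho j).symm)]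
        exact ⟨_, hc.min hc'⟩
  rintro θ ⟨w, hw, hθ⟩
  obtain ⟨j, hj⟩ := hθ.exists_coeff_ne_top
  have hw0 : w ≠ 0 := fun h => orderTop_ne_top.1 hj (by simp [h])
  exact (mem_tropSpan_iff S θ).2 (key _ w rfl hw hw0 θ hθ)

/-- Lifts to W satisfy a nontrivial linear relation, and the orders of its coefficients serve as the
tropical coefficients. -/
theorem tropDependent_of_subset_tropSeries [Nonempty Γ.Point] {B : ℝ}
    (hf : ∀ j p, |f j p| ≤ B) {T : Finset (Γ.Point → ℝ)}
    (hT : (T : Set (Γ.Point → ℝ)) ⊆ tropSeries f W)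
    (hcard : Module.finrank (HahnSeries ℝ ℚ) W < T.card) :
    TropDependent T := by
  classical
  have hT' : ∀ g : T, ∃ w : W, IsTropComb f (fun j => (w.1 j).orderTop) g.1 := by
    intro g
    obtain ⟨w, hw, h⟩ := hT g.2
    exact ⟨⟨w, hw⟩, h⟩
  choose w hw using hT'
  have hdep : ¬ LinearIndependent (HahnSeries ℝ ℚ) w := by
    intro h
    have := h.fintype_card_le_finrank
    rw [Fintype.card_coe] at this
    omega
  obtain ⟨b, hb, g₀, hg₀⟩ := Fintype.not_linearIndependent_iff.1 hdep
  have hbound : ∀ g : T, ∃ B', ∀ p, |g.1 p| ≤ B' := fun g => (hw g).exists_bound hf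
  choose B' hB' using hbound
  -- Members with zero coefficient in the relation get a constant so large that, by boundedness,
  -- they always lie above g₀ and never attain the minimum.
  let a : T → ℝ := fun g => if b g = 0 then (b g₀).order + B' g₀ + B' g + 1 else (b g).order
  refine ⟨fun g => if h : g ∈ T then a ⟨g, h⟩ else 0, fun p => ?_⟩
  obtain ⟨g₁, -, hmin⟩ := Finset.exists_min_image Finset.univ (fun g : T => g.1 p + a g)
    ⟨g₀, Finset.mem_univ _⟩
  have hg₁ : b g₁ ≠ 0 := by
    intro h
    have h1 := hmin g₀ (Finset.mem_univ _)
    simp only [a, h, hg₀, if_true, if_false] at h1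
    have h2 := abs_le.1 (hB' g₁ p)
    have h3 := abs_le.1 (hB' g₀ p)
    linarith
  obtain ⟨j, hj⟩ := (hw g₁ p).2
  beta_reduce at hj
  have hwj : (w g₁).1 j ≠ 0 := by
    intro h
    rw [h, orderTop_zero, add_top] at hj
    exact WithTop.coe_ne_top hj
  rw [← order_eq_orderTop_of_ne_zero hwj, ← WithTop.coe_add, WithTop.coe_inj] at hj
  have hsum : ∑ g : T, b g * (w g).1 j = 0 := by
    have := congrArg (fun x : W => x.1 j) hb
    simpa [Finset.sum_apply] using this
  have hcoef : (b g₁ * (w g₁).1 j).coeff (b g₁ * (w g₁).1 j).order ≠ 0 := by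
    rw [← leadingCoeff_eq]
    exact leadingCoeff_ne_zero.2 (mul_ne_zero hg₁ hwj)
  -- In the j-th coordinate of the relation the leading term coming from g₁ must cancel against
  -- another member g₂; comparing orders shows that g₂ also attains the minimum at p.
  obtain ⟨g₂, hne, hg₂⟩ : ∃ g₂, g₂ ≠ g₁ ∧
      (b g₂ * (w g₂).1 j).coeff (b g₁ * (w g₁).1 j).order ≠ 0 := by
    by_contra hcon
    push Not at hcon
    have h1 := congrArg (fun x : HahnSeries ℝ ℚ => x.coeff (b g₁ * (w g₁).1 j).order) hsum
    simp only [coeff_sum, coeff_zero] at h1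
    rw [Finset.sum_eq_single g₁ (fun g _ hg => hcon g hg) (by simp)] at h1
    exact hcoef h1
  have hb₂ : b g₂ ≠ 0 := by
    intro h
    simp [h] at hg₂
  have hw₂ : (w g₂).1 j ≠ 0 := by
    intro h
    simp [h] at hg₂
  have hord : (b g₂).order + ((w g₂).1 j).order ≤ (b g₁).order + ((w g₁).1 j).order := by
    have := orderTop_le_of_coeff_ne_zero hg₂
    rwa [← order_eq_orderTop_of_ne_zero (mul_ne_zero hb₂ hw₂), WithTop.coe_le_coe,
      order_mul hb₂ hw₂, order_mul hg₁ hwj] at this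
  have hle := (hw g₂ p).1 j
  beta_reduce at hle
  rw [← order_eq_orderTop_of_ne_zero hw₂, ← WithTop.coe_add, WithTop.coe_le_coe] at hle
  have h21 : g₂.1 p + a g₂ ≤ g₁.1 p + a g₁ := by
    simp only [a, hb₂, hg₁, if_false]
    linarith
  refine ⟨g₁, g₁.2, g₂, g₂.2, fun h => hne (Subtype.ext h.symm), ?_, fun h hh => ?_⟩
  · simp only [g₁.2, g₂.2, dif_pos]
    exact le_antisymm (hmin g₂ (Finset.mem_univ _)) h21
  · simp only [g₁.2, hh, dif_pos]
    exact hmin ⟨h, hh⟩ (Finset.mem_univ _)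

end MetricGraph

/-! ### Subspaces of prescribed dimension and strong recursiveness -/

section Recursion

variable {X ι : Type*} [Fintype ι] {f : ι → X → ℝ}
  {W : Submodule (HahnSeries ℝ ℚ) (ι → HahnSeries ℝ ℚ)}

theorem Submodule.exists_finrank_eq_of_le {K V : Type*} [Field K] [AddCommGroup V] [Module K V]
    [FiniteDimensional K V] {U W : Submodule K V} (h : U ≤ W) {n : ℕ}
    (hU : Module.finrank K U ≤ n) (hW : n ≤ Module.finrank K W) :
    ∃ U', U ≤ U' ∧ U' ≤ W ∧ Module.finrank K U' = n := by
  induction n with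
  | zero => exact ⟨U, le_rfl, h, by omega⟩
  | succ n ih =>
    rcases Nat.lt_or_ge n (Module.finrank K U) with hlt | hge
    · exact ⟨U, le_rfl, h, by omega⟩
    obtain ⟨U', hUU', hU'W, hn⟩ := ih hge (by omega)
    have hne : U' ≠ W := by
      rintro rfl
      omega
    obtain ⟨x, hxW, hxU⟩ := SetLike.exists_of_lt (lt_of_le_of_ne hU'W hne)
    refine ⟨U' ⊔ span K {x}, hUU'.trans le_sup_left,
      sup_le hU'W ((span_singleton_le_iff_mem _ _).2 hxW), ?_⟩
    have h1 : Module.finrank K ↥(U' ⊔ span K {x}) ≤ n + 1 := by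
      refine (Submodule.finrank_add_le_finrank_add_finrank _ _).trans ?_
      rw [hn]
      exact Nat.add_le_add_left ((finrank_span_le_card {x}).trans (by simp)) n
    have h2 : Module.finrank K U' < Module.finrank K ↥(U' ⊔ span K {x}) :=
      finrank_lt_finrank_of_lt (left_lt_sup.2 fun hle =>
        hxU (hle (mem_span_singleton_self x)))
    omega

theorem exists_le_subset_tropSeries {T : Finset (X → ℝ)}
    (hT : (T : Set (X → ℝ)) ⊆ tropSeries f W) {n : ℕ} (hTn : T.card ≤ n)
    (hn : n ≤ Module.finrank (HahnSeries ℝ ℚ) W) :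
    ∃ W' ≤ W, (T : Set (X → ℝ)) ⊆ tropSeries f W' ∧ Module.finrank (HahnSeries ℝ ℚ) W' = n := by
  have hT' : ∀ g : T, ∃ w ∈ W, IsTropComb f (fun j => (w j).orderTop) g.1 := fun g => hT g.2
  choose w hwW hw using hT'
  obtain ⟨W', hle, hW', hfin⟩ := Submodule.exists_finrank_eq_of_le
    (U := Submodule.span _ (Set.range w)) (W := W) (n := n)
    (Submodule.span_le.2 (by rintro _ ⟨g, rfl⟩; exact hwW g))
    ((finrank_range_le_card w).trans (by rwa [Fintype.card_coe])) hn
  exact ⟨W', hW', fun g hg => ⟨w ⟨g, hg⟩, hle (Submodule.subset_span ⟨_, rfl⟩), hw ⟨g, hg⟩⟩, hfin⟩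

end Recursion

namespace MetricGraph

variable {Γ : MetricGraph} {ι : Type*} [Fintype ι] {f : ι → Γ.Point → ℝ} {D : Divisor Γ}

theorem isStronglyRecursive_tropSeries {r : ℕ}
    (h : ∀ n ≤ r, ∀ W : Submodule (HahnSeries ℝ ℚ) (ι → HahnSeries ℝ ℚ),
      Module.finrank (HahnSeries ℝ ℚ) W = n + 1 → IsTropicalLinearSeries D n (tropSeries f W))
    {n : ℕ} (hn : n ≤ r) {W : Submodule (HahnSeries ℝ ℚ) (ι → HahnSeries ℝ ℚ)}
    (hW : Module.finrank (HahnSeries ℝ ℚ) W = n + 1) : IsStronglyRecursive D n (tropSeries f W) := by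
  induction n using Nat.strong_induction_on generalizing W with
  | _ n ih =>
    rw [IsStronglyRecursive]
    refine ⟨h n hn W hW, fun h1 T hT hTn => ?_, fun s₁ s₂ hs₁ hs₂ hs S₁ S₂ hS₁ hS₂ hc₁ hc₂ => ?_⟩
    · obtain ⟨W', hW', hTW', hfin⟩ := exists_le_subset_tropSeries hT hTn.le (by omega)
      exact ⟨_, tropSeries_mono hW', hTW', ih (n - 1) (by omega) (by omega) (by omega)⟩
    · obtain ⟨W₁, hW₁, hSW₁, hfin₁⟩ := exists_le_subset_tropSeries hS₁ hc₁.le (by omega)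
      obtain ⟨W₂, hW₂, hSW₂, hfin₂⟩ := exists_le_subset_tropSeries hS₂ hc₂.le (by omega)
      have hsup : Module.finrank (HahnSeries ℝ ℚ) ↥(W₁ ⊔ W₂) ≤ Module.finrank (HahnSeries ℝ ℚ) W :=
        Submodule.finrank_mono (sup_le hW₁ hW₂)
      have hinf := Submodule.finrank_sup_add_finrank_inf_eq W₁ W₂
      -- As W₁ + W₂ has dimension at most n + 1, the intersection has dimension at least s₁ + s₂ - n
      -- - 1, one more than the required rank.
      obtain ⟨W₃, -, hW₃, hfin₃⟩ := Submodule.exists_finrank_eq_of_le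
        (bot_le : ⊥ ≤ W₁ ⊓ W₂) (n := s₁ + s₂ - n - 1) (by simp) (by omega)
      exact ⟨_, tropSeries_mono hW₁, _, tropSeries_mono hW₂, hSW₁,
        ih (s₁ - 1) (by omega) (by omega) (by omega), hSW₂,
        ih (s₂ - 1) (by omega) (by omega) (by omega), tropSeries f W₃,
        Set.subset_inter (tropSeries_mono (hW₃.trans inf_le_left))
          (tropSeries_mono (hW₃.trans inf_le_right)),
        ih (s₁ + s₂ - n - 2) (by omega) (by omega) (by omega)⟩

end MetricGraph

/-! ### Slopes of tropical combinations -/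

open Classical in
/-- The terms of a tropical combination that attain the minimum at `p`. -/
noncomputable def tropActive {X ι : Type*} [Fintype ι] (f : ι → X → ℝ) (c : ι → WithTop ℝ)
    (θ : X → ℝ) (p : X) : Finset ι :=
  Finset.univ.filter fun j => (θ p : WithTop ℝ) = f j p + c j

theorem mem_tropActive {X ι : Type*} [Fintype ι] {f : ι → X → ℝ} {c : ι → WithTop ℝ}
    {θ : X → ℝ} {p : X} {j : ι} :
    j ∈ tropActive f c θ p ↔ (θ p : WithTop ℝ) = f j p + c j := by
  simp [tropActive]

theorem IsTropComb.tropActive_nonempty {X ι : Type*} [Fintype ι] {f : ι → X → ℝ}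
    {c : ι → WithTop ℝ} {θ : X → ℝ} (h : IsTropComb f c θ) (p : X) :
    (tropActive f c θ p).Nonempty := by
  obtain ⟨j, hj⟩ := (h p).2
  exact ⟨j, mem_tropActive.2 hj⟩

namespace MetricGraph

variable {Γ : MetricGraph}

/-- Terms not attaining the minimum at p stay strictly above it nearby, so only the active terms
compete, and the smallest of their slopes wins. -/
theorem hasSlope_of_isTropComb {ι : Type*} [Fintype ι] {f : ι → Γ.Point → ℝ}
    {c : ι → WithTop ℝ} {θ : Γ.Point → ℝ} (h : IsTropComb f c θ) {p : Γ.Point} {η : Tangent p}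
    {m : ι → ℤ} (hm : ∀ j, HasSlope (f j) p η (m j)) :
    HasSlope θ p η ((tropActive f c θ p).inf' (h.tropActive_nonempty p) m) := by
  obtain ⟨j₀, hj₀, hM⟩ := Finset.exists_mem_eq_inf' (h.tropActive_nonempty p) m
  rw [hM]
  have hmin : ∀ j ∈ tropActive f c θ p, m j₀ ≤ m j := fun j hj => hM ▸ Finset.inf'_le m hj
  have hlow : ∀ j, ∀ᶠ s in 𝓝[>] (0 : ℝ),
      ((θ p + m j₀ * s : ℝ) : WithTop ℝ) ≤ f j (ray p η s) + c j := by
    intro j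
    by_cases hc : c j = ⊤
    · simp [hc]
    obtain ⟨t, ht⟩ := WithTop.ne_top_iff_exists.1 hc
    simp only [← ht, ← WithTop.coe_add, WithTop.coe_le_coe]
    by_cases hj : j ∈ tropActive f c θ p
    · have h1 := mem_tropActive.1 hj
      rw [← ht, ← WithTop.coe_add, WithTop.coe_inj] at h1
      filter_upwards [hm j, self_mem_nhdsWithin] with s hs hs0
      have h2 : (m j₀ : ℝ) * s ≤ m j * s :=
        mul_le_mul_of_nonneg_right (by exact_mod_cast hmin j hj) (le_of_lt hs0)
      rw [hs]
      linarith
    · have h1 : θ p < f j p + t := by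
        have h1 := (h p).1 j
        have h2 : (θ p : WithTop ℝ) ≠ f j p + c j := fun h' => hj (mem_tropActive.2 h')
        have h3 := lt_of_le_of_ne h1 h2
        rwa [← ht, ← WithTop.coe_add, WithTop.coe_lt_coe] at h3
      have h2 : Tendsto (fun s : ℝ => θ p + m j₀ * s) (𝓝[>] 0) (𝓝 (θ p)) :=
        tendsto_nhdsWithin_of_tendsto_nhds
          ((by fun_prop : Continuous fun s : ℝ => θ p + m j₀ * s).tendsto' 0 _ (by simp))
      have h3 : Tendsto (fun s : ℝ => f j p + m j * s + t) (𝓝[>] 0) (𝓝 (f j p + t)) :=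
        tendsto_nhdsWithin_of_tendsto_nhds
          ((by fun_prop : Continuous fun s : ℝ => f j p + m j * s + t).tendsto' 0 _ (by simp))
      filter_upwards [h2.eventually_lt h3 h1, hm j] with s hs hs'
      rw [hs']
      exact hs.le
  filter_upwards [eventually_all.2 hlow, hm j₀] with s hs hs₀
  refine le_antisymm ?_ ?_
  · have h1 := (h (ray p η s)).1 j₀
    have h2 := mem_tropActive.1 hj₀
    cases hc : c j₀ with
    | top =>
      rw [hc, add_top] at h2
      exact absurd h2 WithTop.coe_ne_top
    | coe t =>
      rw [hc, ← WithTop.coe_add, WithTop.coe_le_coe] at h1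
      rw [hc, ← WithTop.coe_add, WithTop.coe_inj] at h2
      rw [hs₀] at h1
      linarith
  · obtain ⟨j, hj⟩ := (h (ray p η s)).2
    have h1 := hs j
    rwa [← hj, WithTop.coe_le_coe] at h1

theorem slope_of_isTropComb {ι : Type*} [Fintype ι] {f : ι → Γ.Point → ℝ}
    {c : ι → WithTop ℝ} {θ : Γ.Point → ℝ} (h : IsTropComb f c θ) {p : Γ.Point} {η : Tangent p}
    {m : ι → ℤ} (hm : ∀ j, HasSlope (f j) p η (m j)) :
    slope θ p η = (tropActive f c θ p).inf' (h.tropActive_nonempty p) m :=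
  (hasSlope_of_isTropComb h hm).slope_eq

theorem ordAt_interior (θ : Γ.Point → ℝ) (q : Σ e : Γ.E, Set.Ioo (0 : ℝ) (Γ.len e)) :
    ordAt θ (.inr q) = -(slope θ (.inr q) (true : Bool) + slope θ (.inr q) (false : Bool)) := by
  let e : Tangent (.inr q : Γ.Point) ≃ Bool := Equiv.refl Bool
  have h := Fintype.sum_equiv e
    (fun η => slope θ (.inr q) η) (fun b : Bool => slope θ (.inr q) b) (fun _ => rfl)
  exact congrArg Neg.neg (h.trans (Fintype.sum_bool _))

/-! ### Vanishing conditions -/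

/-- The trailing degree is the multiplicity of the root 0, which is disjoint from the roots in `Y`.
-/
theorem _root_.Polynomial.natTrailingDegree_add_card_le {F : Type*} [Field F]
    {Q : Polynomial F} (hQ : Q ≠ 0) {Y : Finset F} (h0 : 0 ∉ Y) (hY : ∀ y ∈ Y, Q.eval y = 0) :
    Q.natTrailingDegree + Y.card ≤ Q.natDegree := by
  classical
  have h : Y.card + Q.roots.count 0 ≤ Q.natDegree := by
    refine le_trans ?_ Q.card_roots'
    rw [← Multiset.card_replicate (Q.roots.count 0) (0 : F), ← Finset.card_val,
      ← Multiset.card_add]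
    refine Multiset.card_le_card ?_
    rw [Multiset.le_iff_count]
    intro y
    rw [Multiset.count_add, Multiset.count_replicate]
    by_cases hy : y ∈ Y
    · have hy0 : (0 : F) ≠ y := by
        rintro rfl
        exact h0 hy
      rw [Multiset.count_eq_one_of_mem Y.nodup hy, if_neg hy0, add_zero,
        Multiset.one_le_count_iff_mem, Polynomial.mem_roots hQ]
      exact hY y hy
    · rw [Multiset.count_eq_zero_of_notMem (by simpa using hy), zero_add]
      split_ifs with h
      · rw [h]
      · exact Nat.zero_le _
  rw [Polynomial.count_roots, Polynomial.rootMultiplicity_eq_natTrailingDegree'] at h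
  omega

theorem exists_mem_tropActive_of_vanishing {X ι : Type*} [Fintype ι] {f : ι → X → ℝ}
    {w : ι → HahnSeries ℝ ℚ} {θ : X → ℝ} (h : IsTropComb f (fun j => (w j).orderTop) θ) (p : X)
    {n : ι → ℕ} (hn : Function.Injective n) {Y : Finset ℚ} (h0 : 0 ∉ Y)
    (hY : ∀ y ∈ Y, ∑ j, w j * single (f j p) (y ^ n j) = 0) :
    ∃ j₁ ∈ tropActive f (fun j => (w j).orderTop) θ p,
      ∃ j₂ ∈ tropActive f (fun j => (w j).orderTop) θ p, n j₁ + Y.card ≤ n j₂ := by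
  classical
  -- This coefficient is nonzero exactly when j is active at p. Assembled into the polynomial Q
  -- below, these make Q(y) the coefficient of t^{θ(p)} in the vanishing sum.
  let a : ι → ℚ := fun j => (w j).coeff (θ p - f j p)
  have ha : ∀ j, a j ≠ 0 ↔ j ∈ tropActive f (fun j => (w j).orderTop) θ p := by
    intro j
    rw [mem_tropActive]
    have hsplit : (θ p : WithTop ℝ) = f j p + ((θ p - f j p : ℝ) : WithTop ℝ) := by
      rw [← WithTop.coe_add, add_sub_cancel]
    have hle : ((θ p - f j p : ℝ) : WithTop ℝ) ≤ (w j).orderTop := by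
      have := (h p).1 j
      rw [hsplit] at this
      exact (WithTop.add_le_add_iff_left WithTop.coe_ne_top).1 this
    constructor
    · intro hne
      rw [hsplit, le_antisymm hle (orderTop_le_of_coeff_ne_zero hne)]
    · intro heq
      rw [hsplit] at heq
      exact coeff_orderTop_ne (WithTop.add_left_cancel WithTop.coe_ne_top heq).symm
  let Q : Polynomial ℚ := ∑ j, Polynomial.monomial (n j) (a j)
  have hcoeff : ∀ k, Q.coeff k = ∑ j, if n j = k then a j else 0 := by
    intro k
    simp [Q, Polynomial.finsetSum_coeff, Polynomial.coeff_monomial]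
  have hcoeffn : ∀ j, Q.coeff (n j) = a j := by
    intro j
    rw [hcoeff, Finset.sum_eq_single j (fun k _ hk => if_neg fun h' => hk (hn h')) (by simp),
      if_pos rfl]
  have hex : ∀ k, Q.coeff k ≠ 0 → ∃ j, n j = k ∧ a j ≠ 0 := by
    intro k hk
    rw [hcoeff] at hk
    obtain ⟨j, -, hj⟩ := Finset.exists_ne_zero_of_sum_ne_zero hk
    by_cases hjk : n j = k
    · exact ⟨j, hjk, by simpa [hjk] using hj⟩
    · simp [hjk] at hj
  have hQ : Q ≠ 0 := by
    obtain ⟨j, hj⟩ := h.tropActive_nonempty p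
    intro hQ
    have := hcoeffn j
    rw [hQ, Polynomial.coeff_zero] at this
    exact (ha j).2 hj this.symm
  have heval : ∀ y ∈ Y, Q.eval y = 0 := by
    intro y hy
    have h1 := congrArg (fun x : HahnSeries ℝ ℚ => x.coeff (θ p)) (hY y hy)
    simp only [coeff_sum, coeff_zero] at h1
    rw [← h1, Polynomial.eval_finsetSum]
    refine Finset.sum_congr rfl fun j _ => ?_
    have h2 := coeff_mul_single_add (r := y ^ n j) (x := w j) (a := θ p - f j p) (b := f j p)
    rw [sub_add_cancel] at h2
    rw [h2, Polynomial.eval_monomial]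
  have hle := Polynomial.natTrailingDegree_add_card_le hQ h0 heval
  obtain ⟨j₁, hj₁, ha₁⟩ := hex Q.natTrailingDegree
    (Polynomial.mem_support_iff.1 (Polynomial.natTrailingDegree_mem_support_of_nonzero hQ))
  obtain ⟨j₂, hj₂, ha₂⟩ := hex Q.natDegree
    (Polynomial.mem_support_iff.1 (Polynomial.natDegree_mem_support_of_nonzero hQ))
  exact ⟨j₁, (ha j₁).1 ha₁, j₂, (ha j₂).1 ha₂, by rw [hj₁, hj₂]; exact hle⟩

/-! ### Functions on the star -/

section Star

variable {d : ℕ} {ℓ : ℝ} {hℓ : 0 < ℓ}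

/-- The function on the star that vanishes at the center and has constant slope `m i` along the
`i`-th edge. -/
def starFun (hℓ : 0 < ℓ) (m : Fin d → ℕ) : (star d ℓ hℓ).Point → ℝ :=
  Sum.elim (fun v : Option (Fin d) => v.elim 0 fun i => m i * ℓ) fun q => m q.1 * q.2.1

/-- The absolute slope of `starFun hℓ m` on the edge containing the point (zero at the center). -/
def starMult (hℓ : 0 < ℓ) (m : Fin d → ℕ) : (star d ℓ hℓ).Point → ℕ :=
  Sum.elim (fun v : Option (Fin d) => v.elim 0 m) fun q => m q.1

theorem starFun_edgePt (m : Fin d → ℕ) (i : Fin d) {t : ℝ} (ht : t ∈ Set.Icc 0 ℓ) :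
    starFun hℓ m (edgePt (Γ := star d ℓ hℓ) i t) = m i * t := by
  unfold edgePt
  split_ifs with h1 h2
  · rfl
  · have : t = 0 := le_antisymm h2 ht.1
    simp [this, starFun, star]
  · have : t = ℓ := by
      by_contra hne
      exact h1 ⟨not_le.1 h2, lt_of_le_of_ne ht.2 hne⟩
    simp [this, starFun, star]

theorem hasSlope_starFun_center (m : Fin d → ℕ) (i : Fin d) :
    HasSlope (starFun hℓ m) (starCenter d ℓ hℓ) (starTangent d ℓ hℓ i) (m i) := by
  filter_upwards [Ioo_mem_nhdsGT hℓ] with s hs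
  have := starFun_edgePt (hℓ := hℓ) m i (Set.Ioo_subset_Icc_self hs)
  refine this.trans ?_
  change (m i : ℝ) * s = 0 + ((m i : ℤ) : ℝ) * s
  push_cast
  ring

theorem hasSlope_starFun_leaf (m : Fin d → ℕ) (i : Fin d)
    (η : Tangent (Γ := star d ℓ hℓ) (.inl (some i : Option (Fin d)))) :
    HasSlope (starFun hℓ m) (.inl (some i : Option (Fin d))) η (-(m i : ℤ)) := by
  match η with
  | .inl e => exact absurd e.2.symm (Option.some_ne_none i)
  | .inr e =>
    obtain ⟨e, he⟩ := e
    obtain rfl : e = i := Option.some_injective _ he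
    filter_upwards [Ioo_mem_nhdsGT hℓ] with s hs
    have h := starFun_edgePt (hℓ := hℓ) m e (t := ℓ - s) ⟨by linarith [hs.2], by linarith [hs.1]⟩
    refine h.trans ?_
    change (m e : ℝ) * (ℓ - s) = (m e : ℝ) * ℓ + ((-(m e : ℤ) : ℤ) : ℝ) * s
    push_cast
    ring

theorem hasSlope_starFun_interior_true (m : Fin d → ℕ)
    (q : Σ e : (star d ℓ hℓ).E, Set.Ioo (0 : ℝ) ((star d ℓ hℓ).len e)) :
    HasSlope (starFun hℓ m) (.inr q) (true : Bool) (m q.1 : ℤ) := by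
  obtain ⟨i, t, ht⟩ := q
  have ht' : t ∈ Set.Ioo 0 ℓ := ht
  filter_upwards [Ioo_mem_nhdsGT (sub_pos.2 ht'.2)] with s hs
  have h := starFun_edgePt (hℓ := hℓ) m i (t := t + s)
    ⟨by linarith [hs.1, ht'.1], by linarith [hs.2]⟩
  refine h.trans ?_
  change (m i : ℝ) * (t + s) = (m i : ℝ) * t + ((m i : ℤ) : ℝ) * s
  push_cast
  ring

theorem hasSlope_starFun_interior_false (m : Fin d → ℕ)
    (q : Σ e : (star d ℓ hℓ).E, Set.Ioo (0 : ℝ) ((star d ℓ hℓ).len e)) :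
    HasSlope (starFun hℓ m) (.inr q) (false : Bool) (-(m q.1 : ℤ)) := by
  obtain ⟨i, t, ht⟩ := q
  have ht' : t ∈ Set.Ioo 0 ℓ := ht
  filter_upwards [Ioo_mem_nhdsGT ht'.1] with s hs
  have h := starFun_edgePt (hℓ := hℓ) m i (t := t - s)
    ⟨by linarith [hs.2], by linarith [hs.1, ht'.2]⟩
  refine h.trans ?_
  change (m i : ℝ) * (t - s) = (m i : ℝ) * t + ((-(m i : ℤ) : ℤ) : ℝ) * s
  push_cast
  ring

theorem isPL_starFun (m : Fin d → ℕ) : IsPL (starFun hℓ m) := by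
  intro p η
  match p, η with
  | .inl none, η =>
    obtain ⟨i, rfl⟩ := (starTangent d ℓ hℓ).surjective η
    exact ⟨_, hasSlope_starFun_center m i⟩
  | .inl (some i), η => exact ⟨_, hasSlope_starFun_leaf m i η⟩
  | .inr q, true => exact ⟨_, hasSlope_starFun_interior_true m q⟩
  | .inr q, false => exact ⟨_, hasSlope_starFun_interior_false m q⟩

theorem abs_starFun_le {m : Fin d → ℕ} {B : ℕ} (hm : ∀ i, m i ≤ B) (p : (star d ℓ hℓ).Point) :
    |starFun hℓ m p| ≤ B * ℓ := by
  have hB : ∀ i, ∀ t ∈ Set.Icc 0 ℓ, |(m i : ℝ) * t| ≤ B * ℓ := by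
    intro i t ht
    rw [abs_of_nonneg (mul_nonneg (Nat.cast_nonneg _) ht.1)]
    exact mul_le_mul (by exact_mod_cast hm i) ht.2 ht.1 (Nat.cast_nonneg _)
  match p with
  | .inl none =>
    have : starFun hℓ m (.inl (none : Option (Fin d))) = 0 := rfl
    rw [this, abs_zero]
    positivity
  | .inl (some i) => exact hB i ℓ ⟨hℓ.le, le_rfl⟩
  | .inr q => exact hB q.1 q.2.1 (Set.Ioo_subset_Icc_self q.2.2)

variable {ι : Type*} [Fintype ι] {m : ι → Fin d → ℕ} {c : ι → WithTop ℝ}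
  {θ : (star d ℓ hℓ).Point → ℝ}

theorem isPL_of_isTropComb_starFun (h : IsTropComb (fun j => starFun hℓ (m j)) c θ) : IsPL θ := by
  intro p η
  choose n hn using fun j => isPL_starFun (hℓ := hℓ) (m j) p η
  exact ⟨_, hasSlope_of_isTropComb h hn⟩

theorem slope_starCenter (h : IsTropComb (fun j => starFun hℓ (m j)) c θ) (i : Fin d) :
    slope θ (starCenter d ℓ hℓ) (starTangent d ℓ hℓ i) =
      (tropActive (fun j => starFun hℓ (m j)) c θ (starCenter d ℓ hℓ)).inf'
        (h.tropActive_nonempty _) fun j => (m j i : ℤ) :=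
  slope_of_isTropComb h fun j => hasSlope_starFun_center (m j) i

theorem neg_le_ordAt_starCenter (h : IsTropComb (fun j => starFun hℓ (m j)) c θ) {B : ℕ}
    (hB : ∀ j i, m j i ≤ B) : -((d * B : ℕ) : ℤ) ≤ ordAt θ (starCenter d ℓ hℓ) := by
  rw [ordAt, ← Equiv.sum_comp (starTangent d ℓ hℓ), neg_le_neg_iff]
  have : ∀ i ∈ (Finset.univ : Finset (Fin d)),
      slope θ (starCenter d ℓ hℓ) (starTangent d ℓ hℓ i) ≤ B := by
    intro i _
    rw [slope_starCenter h i]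
    obtain ⟨j, hj⟩ := h.tropActive_nonempty (starCenter d ℓ hℓ)
    exact (Finset.inf'_le _ hj).trans (by exact_mod_cast hB j i)
  refine (Finset.sum_le_card_nsmul _ _ _ this).trans ?_
  simp

/-- Outgoing slopes are minima over active terms: at an interior point j₁ bounds the outward one and
j₂ the inward one. At a leaf j₂ alone suffices. -/
theorem starMult_sub_le_ordAt (h : IsTropComb (fun j => starFun hℓ (m j)) c θ)
    {p : (star d ℓ hℓ).Point} (hp : p ≠ starCenter d ℓ hℓ) {j₁ j₂ : ι}
    (h₁ : j₁ ∈ tropActive (fun j => starFun hℓ (m j)) c θ p)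
    (h₂ : j₂ ∈ tropActive (fun j => starFun hℓ (m j)) c θ p) :
    (starMult hℓ (m j₂) p : ℤ) - starMult hℓ (m j₁) p ≤ ordAt θ p := by
  match p with
  | .inl none => exact absurd rfl hp
  | .inl (some i) =>
    have hs : ∀ η : Tangent (Γ := star d ℓ hℓ) (.inl (some i : Option (Fin d))),
        slope θ (.inl (some i : Option (Fin d))) η ≤ -(m j₂ i : ℤ) := fun η =>
      (slope_of_isTropComb h fun j => hasSlope_starFun_leaf (m j) i η).trans_le
        (Finset.inf'_le _ h₂)
    classical
    let η₀ : Tangent (Γ := star d ℓ hℓ) (.inl (some i : Option (Fin d))) := Sum.inr ⟨i, rfl⟩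
    -- Every summand is nonpositive, so the bound at η₀ suffices without showing that it is the only
    -- tangent vector.
    have hsum : ∑ η : Tangent (Γ := star d ℓ hℓ) (.inl (some i : Option (Fin d))),
        slope θ (.inl (some i : Option (Fin d))) η ≤ -(m j₂ i : ℤ) := by
      refine le_trans ?_ (hs η₀)
      rw [← Finset.add_sum_erase _ _ (Finset.mem_univ η₀)]
      refine add_le_of_nonpos_right (Finset.sum_nonpos fun η _ => (hs η).trans ?_)
      simp
    have hle : (m j₂ i : ℤ) ≤ ordAt θ (.inl (some i : Option (Fin d))) := by
      rw [ordAt]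
      linarith
    have h1 : (0 : ℤ) ≤ (m j₁ i : ℤ) := Int.natCast_nonneg _
    change (m j₂ i : ℤ) - (m j₁ i : ℤ) ≤ _
    linarith
  | .inr q =>
    rw [ordAt_interior]
    have h1 : slope θ (.inr q) (true : Bool) ≤ (m j₁ q.1 : ℤ) :=
      (slope_of_isTropComb h fun j => hasSlope_starFun_interior_true (m j) q).trans_le
        (Finset.inf'_le _ h₁)
    have h2 : slope θ (.inr q) (false : Bool) ≤ -(m j₂ q.1 : ℤ) :=
      (slope_of_isTropComb h fun j => hasSlope_starFun_interior_false (m j) q).trans_le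
        (Finset.inf'_le _ h₂)
    change (m j₂ q.1 : ℤ) - (m j₁ q.1 : ℤ) ≤ _
    linarith

omit [Fintype ι] in
theorem starMult_injective (hm : ∀ i, Function.Injective fun j => m j i)
    {p : (star d ℓ hℓ).Point} (hp : p ≠ starCenter d ℓ hℓ) :
    Function.Injective fun j => starMult hℓ (m j) p := by
  match p with
  | .inl none => exact absurd rfl hp
  | .inl (some i) => exact hm i
  | .inr q => exact hm q.1

/-- A nonzero vector of `W` can be made to vanish to prescribed orders away from the center. -/
theorem exists_vanishing_vector {W : Submodule (HahnSeries ℝ ℚ) (ι → HahnSeries ℝ ℚ)}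
    {E : Divisor (star d ℓ hℓ)} (hE : 0 ≤ E) (hdeg : E.deg < Module.finrank (HahnSeries ℝ ℚ) W) :
    ∃ w ∈ W, w ≠ 0 ∧ ∀ p, ∀ k < (E p).toNat,
      ∑ j, w j * single (starFun hℓ (m j) p) (((k + 1 : ℕ) : ℚ) ^ starMult hℓ (m j) p) = 0 := by
  classical
  -- One equation for each point counted with multiplicity, hence deg E in all; this is less than
  -- dim W, so the kernel meets W nontrivially.
  let κ := Σ p : E.support, Fin (E p).toNat
  let φ : (ι → HahnSeries ℝ ℚ) →ₗ[HahnSeries ℝ ℚ] (κ → HahnSeries ℝ ℚ) :=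
    Fintype.linearCombination (HahnSeries ℝ ℚ) fun j k =>
      single (starFun hℓ (m j) k.1) (((k.2 + 1 : ℕ) : ℚ) ^ starMult hℓ (m j) k.1)
  have hcard : Module.finrank (HahnSeries ℝ ℚ) (κ → HahnSeries ℝ ℚ) <
      Module.finrank (HahnSeries ℝ ℚ) W := by
    rw [Module.finrank_fintype_fun_eq_card, Fintype.card_sigma]
    zify
    refine lt_of_le_of_lt (le_of_eq ?_) hdeg
    rw [Divisor.deg, Finsupp.sum, ← Finset.sum_coe_sort E.support fun p => E p]
    refine Finset.sum_congr rfl fun p _ => ?_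
    rw [Fintype.card_fin, Int.toNat_of_nonneg (hE p)]
  obtain ⟨⟨w, hw⟩, hker, hne⟩ := Submodule.exists_mem_ne_zero_of_ne_bot
    (LinearMap.ker_ne_bot_of_finrank_lt (f := φ.comp W.subtype) hcard)
  refine ⟨w, hw, fun h => hne (Subtype.ext h), fun p k hk => ?_⟩
  have hp : p ∈ E.support := by
    rw [Finsupp.mem_support_iff]
    intro h
    simp [h] at hk
  have := congrFun (LinearMap.mem_ker.1 hker) ⟨⟨p, hp⟩, ⟨k, hk⟩⟩
  simpa [φ, Fintype.linearCombination_apply, Finset.sum_apply] using this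

/-- In the coefficient d * B + r, the first term offsets the d slopes at the center, each at most B,
and the second absorbs whatever part of E lies at the center. -/
theorem isTropicalLinearSeries_star {r n B : ℕ} (hn : n ≤ r) (hB : ∀ j i, m j i ≤ B)
    (hm : ∀ i, Function.Injective fun j => m j i)
    {W : Submodule (HahnSeries ℝ ℚ) (ι → HahnSeries ℝ ℚ)}
    (hW : Module.finrank (HahnSeries ℝ ℚ) W = n + 1) :
    IsTropicalLinearSeries (Finsupp.single (starCenter d ℓ hℓ) ((d * B + r : ℕ) : ℤ)) n
      (tropSeries (fun j => starFun hℓ (m j)) W) := by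
  classical
  have : Nonempty (star d ℓ hℓ).Point := ⟨starCenter d ℓ hℓ⟩
  refine ⟨isFGTropSubmodule_tropSeries, ?_, ?_, fun T hT hTn =>
    tropDependent_of_subset_tropSeries (fun j => abs_starFun_le (hB j)) hT (by omega)⟩
  · rintro θ ⟨w, -, hθ⟩
    refine ⟨isPL_of_isTropComb_starFun hθ, fun p => ?_⟩
    by_cases hp : p = starCenter d ℓ hℓ
    · have := neg_le_ordAt_starCenter hθ hB
      rw [hp, Finsupp.single_eq_same]
      push_cast at this ⊢
      linarith [Int.natCast_nonneg r]
    · rw [Finsupp.single_eq_of_ne hp, zero_add]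
      obtain ⟨j, hj⟩ := hθ.tropActive_nonempty p
      simpa using starMult_sub_le_ordAt hθ hp hj hj
  · intro E hE hdeg
    obtain ⟨w, hw, hw0, hvan⟩ := exists_vanishing_vector (m := m) hE (W := W) (by omega)
    obtain ⟨j, hj⟩ := Function.ne_iff.1 hw0
    obtain ⟨θ, hθ⟩ := IsTropComb.exists_of_ne_top (c := fun j => (w j).orderTop)
      (fun j => starFun hℓ (m j)) (j := j) (orderTop_ne_top.2 hj)
    refine ⟨θ, ⟨w, hw, hθ⟩, fun p => ?_⟩
    by_cases hp : p = starCenter d ℓ hℓ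
    · have h1 := neg_le_ordAt_starCenter hθ hB
      have h2 : E (starCenter d ℓ hℓ) ≤ n := by
        rw [← hdeg, Divisor.deg, Finsupp.sum]
        by_cases hs : starCenter d ℓ hℓ ∈ E.support
        · exact Finset.single_le_sum (f := fun p => E p) (fun p _ => hE p) hs
        · rw [Finsupp.notMem_support_iff.1 hs]
          exact Finset.sum_nonneg fun p _ => hE p
      rw [hp, Finsupp.single_eq_same]
      push_cast at h1 ⊢
      have h3 : (n : ℤ) ≤ r := by exact_mod_cast hn
      linarith
    · rw [Finsupp.single_eq_of_ne hp, zero_add]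
      let Y : Finset ℚ := (Finset.range (E p).toNat).image fun k => ((k + 1 : ℕ) : ℚ)
      have hYcard : Y.card = (E p).toNat := by
        rw [Finset.card_image_of_injective _ (fun a b hab => by simpa using hab),
          Finset.card_range]
      have h0 : (0 : ℚ) ∉ Y := by
        intro h
        obtain ⟨k, -, hk⟩ := Finset.mem_image.1 h
        exact absurd hk (Nat.cast_ne_zero.2 k.succ_ne_zero)
      obtain ⟨j₁, h₁, j₂, h₂, hle⟩ := exists_mem_tropActive_of_vanishing hθ p
        (starMult_injective hm hp) h0 (fun y hy => by
          obtain ⟨k, hk, rfl⟩ := Finset.mem_image.1 hy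
          exact hvan p k (Finset.mem_range.1 hk))
      have h3 := starMult_sub_le_ordAt hθ hp h₁ h₂
      have h4 := Int.toNat_of_nonneg (hE p)
      rw [hYcard] at hle
      omega

end Star

end MetricGraph

/-! ### Meets of dots, and sparseness in dimension two -/

namespace DotArray

variable {d r : ℕ} {P : Set (Fin d → Fin (r + 1))}

/-- Members sharing no coordinate with the meet can be dropped without changing it. If one member
remains, the meet is a dot; otherwise it is redundant. -/
theorem inf_mem_redundantClosure {H : Finset (Fin d → Fin (r + 1))} (hH : H.Nonempty)
    (hHP : (H : Set (Fin d → Fin (r + 1))) ⊆ P) : H.inf id ∈ redundantClosure P := by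
  classical
  by_cases hd : IsEmpty (Fin d)
  · obtain ⟨y, hy⟩ := hH
    exact Or.inl (Subsingleton.elim y (H.inf id) ▸ hHP hy)
  obtain ⟨i₀⟩ := not_isEmpty_iff.1 hd
  have hex : ∀ i, ∃ y ∈ H, y i = H.inf id i := by
    intro i
    obtain ⟨y, hy, h⟩ := Finset.exists_mem_eq_inf' hH fun y : Fin d → Fin (r + 1) => y i
    refine ⟨y, hy, ?_⟩
    rw [Finset.inf_apply, ← Finset.inf'_eq_inf hH]
    exact h.symm
  let H' := H.filter fun y => ∃ i, y i = H.inf id i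
  have hinf : H'.inf id = H.inf id := by
    refine le_antisymm (fun i => ?_) (Finset.inf_mono (Finset.filter_subset _ _))
    obtain ⟨y, hy, h⟩ := hex i
    rw [← h]
    exact (Finset.inf_le (f := id) (Finset.mem_filter.2 ⟨hy, i, h⟩) : H'.inf id ≤ y) i
  have hH'P : (H' : Set (Fin d → Fin (r + 1))) ⊆ P := fun y hy =>
    hHP (Finset.mem_filter.1 hy).1
  have hne : H'.Nonempty := by
    obtain ⟨y, hy, h⟩ := hex i₀
    exact ⟨y, Finset.mem_filter.2 ⟨hy, i₀, h⟩⟩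
  rcases Nat.lt_or_ge H'.card 2 with hlt | hge
  · left
    obtain ⟨y, hy⟩ := Finset.card_eq_one.1 (by have := hne.card_pos; omega : H'.card = 1)
    rw [← hinf, hy, Finset.inf_singleton]
    exact hH'P (by simp [hy])
  · exact Or.inr ⟨H', hH'P, hge, hinf, fun y hy => (Finset.mem_filter.1 hy).2⟩

theorem exists_inf_eq_of_mem_redundantClosure {x : Fin d → Fin (r + 1)}
    (hx : x ∈ redundantClosure P) : ∃ H : Finset (Fin d → Fin (r + 1)), H.Nonempty ∧
      (H : Set (Fin d → Fin (r + 1))) ⊆ P ∧ H.inf id = x := by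
  rcases hx with hx | ⟨H, hHP, hcard, hinf, -⟩
  · exact ⟨{x}, by simp, by simpa using hx, by simp⟩
  · exact ⟨H, Finset.card_pos.1 (by omega), hHP, hinf⟩

theorem IsSparsePermutationArray.bijective (hP : IsSparsePermutationArray P) (i : Fin d) :
    Function.Bijective fun x : P => x.1 i := by
  refine ⟨fun x y hxy => Subtype.ext ?_, fun n => ?_⟩
  · exact (hP i (x.1 i)).unique ⟨x.2, rfl⟩ ⟨y.2, hxy.symm⟩
  · obtain ⟨x, ⟨hx, hn⟩, -⟩ := hP i n
    exact ⟨⟨x, hx⟩, hn⟩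

/-- Distinct dots of a two-dimensional permutation array do not share a coordinate. -/
theorem IsPermutationArray.not_lt_of_eq {P : Set (Fin 2 → Fin (r + 1))}
    (hP : IsPermutationArray P) {i j : Fin 2} (hij : i ≠ j) {x y : Fin 2 → Fin (r + 1)}
    (hx : x ∈ P) (hy : y ∈ P) (hi : x i = y i) : ¬ x j < y j := by
  classical
  intro hj
  have hcases : ∀ k, k = i ∨ k = j := by
    intro k
    omega
  have hle : ∀ {u v : Fin 2 → Fin (r + 1)}, u ≤ v ↔ u i ≤ v i ∧ u j ≤ v j := by
    intro u v
    refine ⟨fun h => ⟨h i, h j⟩, fun h k => ?_⟩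
    rcases hcases k with rfl | rfl
    exacts [h.1, h.2]
  have hjr : (x j : ℕ) + 1 < r + 1 := by
    have := (y j).2
    have : (x j : ℕ) < y j := hj
    omega
  -- Raising x by one in direction j discards the value x j from the principal subarray but keeps y.
  -- The rank drops in direction j, hence also in direction i by total rankability.
  let z := Function.update x j ⟨x j + 1, hjr⟩
  have hzi : z i = x i := Function.update_of_ne hij _ _
  have hzj : ∀ u : Fin (r + 1), z j ≤ u ↔ x j < u := by
    intro u
    simp only [z, Function.update_self]
    exact Iff.rfl
  have hyx : y ∈ principal P z := ⟨hy, hle.2 ⟨by rw [hzi, hi], (hzj _).2 hj⟩⟩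
  have hsub : principal P z ⊆ principal P x := fun u hu =>
    ⟨hu.1, hle.2 ⟨hzi ▸ hu.2 i, ((hzj _).1 (hu.2 j)).le⟩⟩
  have hlt : ((fun u : Fin 2 → Fin (r + 1) => u j) '' principal P z).ncard <
      ((fun u : Fin 2 → Fin (r + 1) => u j) '' principal P x).ncard := by
    refine Set.ncard_lt_ncard ((Set.ssubset_iff_of_subset (Set.image_mono hsub)).2
      ⟨x j, ⟨x, ⟨hx, le_rfl⟩, rfl⟩, ?_⟩)
    rintro ⟨u, hu, huj⟩
    exact ((hzj _).1 (hu.2 j)).ne huj.symm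
  obtain ⟨s, hs⟩ := hP.totallyRankable x
  obtain ⟨t, ht⟩ := hP.totallyRankable z
  have h1 := hs i
  have h2 := hs j
  have h3 := ht i
  have h4 := ht j
  rw [rankAlong] at h1 h2 h3 h4
  -- The lost i-value comes from a dot u with u j = x j and u i > x i, so x is the meet of y and u,
  -- contradicting irredundancy.
  obtain ⟨_, ⟨u, hu, rfl⟩, hun⟩ := Set.exists_mem_notMem_of_ncard_lt_ncard
    (s := (fun u : Fin 2 → Fin (r + 1) => u i) '' principal P z)
    (t := (fun u : Fin 2 → Fin (r + 1) => u i) '' principal P x) (by omega)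
  have hui : x i < u i := lt_of_le_of_ne (hu.2 i) fun h => hun ⟨y, hyx, hi.symm.trans h⟩
  have huj : u j = x j := by
    by_contra hne
    exact hun ⟨u, ⟨hu.1, hle.2 ⟨hzi ▸ hu.2 i,
      (hzj _).2 (lt_of_le_of_ne (hu.2 j) (Ne.symm hne))⟩⟩, rfl⟩
  have hyu : y ≠ u := by
    rintro rfl
    exact hui.ne hi
  refine Set.disjoint_left.1 hP.not_redundant hx
    ⟨{y, u}, ?_, (Finset.card_pair hyu).ge, ?_, ?_⟩
  · intro v hv
    rcases Finset.mem_insert.1 (Finset.mem_coe.1 hv) with rfl | hv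
    · exact hy
    · rw [Finset.mem_singleton.1 hv]
      exact hu.1
  · funext k
    rw [Finset.inf_insert, Finset.inf_singleton]
    rcases hcases k with rfl | rfl
    · exact (min_eq_left (hi.symm.trans_le hui.le) : min (y k) (u k) = y k).trans hi.symm
    · exact (min_eq_right (huj.trans_le hj.le) : min (y k) (u k) = u k).trans huj
  · intro v hv
    rcases Finset.mem_insert.1 hv with rfl | hv
    · exact ⟨i, hi.symm⟩
    · rw [Finset.mem_singleton.1 hv]
      exact ⟨j, huj⟩

/-- Rank r makes every coordinate value occur; two dots sharing one coordinate agree in the other as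
well, since neither can be smaller there. -/
theorem IsPermutationArray.isSparse {P : Set (Fin 2 → Fin (r + 1))}
    (hP : IsPermutationArray P) : IsSparsePermutationArray P := by
  intro i n
  have hsurj : (fun x : Fin 2 → Fin (r + 1) => x i) '' P = Set.univ := by
    refine Set.eq_of_subset_of_ncard_le (Set.subset_univ _) ?_
    have h := hP.rank_eq i
    rw [rankAlong] at h
    rw [Set.ncard_univ, Nat.card_eq_fintype_card, Fintype.card_fin]
    omega
  obtain ⟨x, hx, hxn⟩ : n ∈ (fun x : Fin 2 → Fin (r + 1) => x i) '' P := by simp [hsurj]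
  refine ⟨x, ⟨hx, hxn⟩, fun y ⟨hy, hyn⟩ => ?_⟩
  have hxy : x i = y i := by rw [hyn]; exact hxn
  obtain ⟨j, hij, hcases⟩ : ∃ j, i ≠ j ∧ ∀ k, k = i ∨ k = j := ⟨1 - i, by omega, by omega⟩
  funext k
  rcases hcases k with rfl | rfl
  · exact hxy.symm
  · exact le_antisymm (not_lt.1 (hP.not_lt_of_eq hij hx hy hxy))
      (not_lt.1 (hP.not_lt_of_eq hij hy hx hxy.symm))

end DotArray

/-! ### The series attached to a sparse array and its local array -/

namespace MetricGraph

theorem exists_isStronglyRecursive_isLocalArray_star (d r : ℕ) (ℓ : ℝ) (hℓ : 0 < ℓ) (hd : 1 ≤ d)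
    {P : Set (Fin d → Fin (r + 1))} (hP : DotArray.IsSparsePermutationArray P) :
    ∃ (D : Divisor (star d ℓ hℓ)) (L : Set ((star d ℓ hℓ).Point → ℝ)),
      IsStronglyRecursive D r L ∧
      IsLocalArray L (starCenter d ℓ hℓ) (starTangent d ℓ hℓ) (DotArray.redundantClosure P) := by
  classical
  let m : P → Fin d → ℕ := fun x i => x.1 i
  have hm : ∀ i, Function.Injective fun j => m j i := fun i x y hxy =>
    (hP.bijective i).1 (Fin.ext hxy)
  have hB : ∀ j i, m j i ≤ r := fun j i => Nat.le_of_lt_succ (j.1 i).2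
  have hcard : Fintype.card P = r + 1 := by
    rw [Fintype.card_of_bijective (hP.bijective ⟨0, hd⟩), Fintype.card_fin]
  refine ⟨Finsupp.single (starCenter d ℓ hℓ) ((d * r + r : ℕ) : ℤ),
    tropSeries (fun j => starFun hℓ (m j)) ⊤,
    isStronglyRecursive_tropSeries (fun n hn W hW => isTropicalLinearSeries_star hn hB hm hW) le_rfl
      (by rw [finrank_top, Module.finrank_fintype_fun_eq_card, hcard]), ?_⟩
  have hslope : ∀ {c : P → WithTop ℝ} {θ : (star d ℓ hℓ).Point → ℝ}
      (h : IsTropComb (fun j => starFun hℓ (m j)) c θ) {H : Finset (Fin d → Fin (r + 1))},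
      H = (tropActive (fun j => starFun hℓ (m j)) c θ (starCenter d ℓ hℓ)).image Subtype.val →
      ∀ i, slope θ (starCenter d ℓ hℓ) (starTangent d ℓ hℓ i) = ((H.inf id i : Fin (r + 1)) : ℕ) := by
    intro c θ h H hH i
    have hne := h.tropActive_nonempty (starCenter d ℓ hℓ)
    rw [slope_starCenter h i, hH, Finset.inf_image, Finset.inf_apply, ← Finset.inf'_eq_inf hne]
    exact (Finset.apply_inf'_eq_inf'_comp hne (fun a : Fin (r + 1) => ((a : ℕ) : ℤ))
      (fun a b => Monotone.map_inf (f := fun a : Fin (r + 1) => ((a : ℕ) : ℤ))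
        (fun a b hab => Int.ofNat_le.2 hab) a b)).symm
  have hmem : ∀ H : Finset (Fin d → Fin (r + 1)), H.Nonempty →
      (H : Set (Fin d → Fin (r + 1))) ⊆ P → ∃ θ ∈ tropSeries (fun j => starFun hℓ (m j)) ⊤,
        ∀ i, slope θ (starCenter d ℓ hℓ) (starTangent d ℓ hℓ i) =
          ((H.inf id i : Fin (r + 1)) : ℕ) := by
    intro H ⟨x, hx⟩ hHP
    -- The entries have order 0 on H and ⊤ off it; as all the generators vanish at the center, the
    -- active set there is exactly H.
    let w : P → HahnSeries ℝ ℚ := fun j => if j.1 ∈ H then 1 else 0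
    obtain ⟨θ, hθ⟩ := IsTropComb.exists_of_ne_top (c := fun j => (w j).orderTop)
      (fun j => starFun hℓ (m j)) (j := ⟨x, hHP hx⟩) (by simp [w, hx])
    have hf : ∀ j, starFun hℓ (m j) (starCenter d ℓ hℓ) = 0 := fun _ => rfl
    have h0 : θ (starCenter d ℓ hℓ) = 0 := by
      refine le_antisymm ?_ ?_
      · have := (hθ (starCenter d ℓ hℓ)).1 ⟨x, hHP hx⟩
        simpa [hf, w, hx] using this
      · obtain ⟨j, hj⟩ := (hθ (starCenter d ℓ hℓ)).2
        by_cases hjH : j.1 ∈ H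
        · simp only [hf, w, hjH, if_true, orderTop_one] at hj
          simp at hj
          exact hj.ge
        · simp [w, hjH] at hj
    refine ⟨θ, ⟨w, trivial, hθ⟩, hslope hθ ?_⟩
    ext y
    simp only [Finset.mem_image, mem_tropActive, hf, h0]
    constructor
    · intro hy
      exact ⟨⟨y, hHP hy⟩, by simp [w, hy], rfl⟩
    · rintro ⟨j, hj, rfl⟩
      by_contra hjH
      simp [w, hjH] at hj
  -- The slope labelled n is n itself, since the coordinates of the dots were used as slopes.
  refine ⟨fun _ n => ((n : ℕ) : ℤ), fun i => ⟨fun a b hab => Int.ofNat_lt.2 hab, ?_⟩, ?_⟩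
  · ext k
    constructor
    · rintro ⟨n, rfl⟩
      obtain ⟨x, ⟨hx, hn⟩, -⟩ := hP i n
      obtain ⟨θ, hθ, hs⟩ := hmem {x} (by simp) (by simpa using hx)
      exact ⟨θ, hθ, by rw [hs i, Finset.inf_singleton, id, hn]⟩
    · rintro ⟨θ, ⟨w, -, hθ⟩, hk⟩
      exact ⟨_, (hslope hθ rfl i).symm.trans hk⟩
  · ext x
    constructor
    · intro hx
      obtain ⟨H, hH, hHP, rfl⟩ := DotArray.exists_inf_eq_of_mem_redundantClosure hx
      exact hmem H hH hHP
    · rintro ⟨θ, ⟨w, -, hθ⟩, hs⟩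
      have hx : x = ((tropActive (fun j => starFun hℓ (m j)) (fun j => (w j).orderTop) θ
          (starCenter d ℓ hℓ)).image Subtype.val).inf id := by
        funext i
        have := (hs i).symm.trans (hslope hθ rfl i)
        exact Fin.ext (Int.ofNat_inj.1 this)
      rw [hx]
      refine DotArray.inf_mem_redundantClosure ((hθ.tropActive_nonempty _).image _) fun y hy => ?_
      obtain ⟨j, -, rfl⟩ := Finset.mem_image.1 (Finset.mem_coe.1 hy)
      exact j.2

end MetricGraph

theorem mainTheorem9 :
    (∀ (d r : ℕ) (ℓ : ℝ) (hℓ : 0 < ℓ), 2 ≤ d → 1 ≤ r →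
      ∀ P : Set (Fin d → Fin (r + 1)), DotArray.IsSparsePermutationArray P →
        ∃ (D : MetricGraph.Divisor (MetricGraph.star d ℓ hℓ))
          (L : Set ((MetricGraph.star d ℓ hℓ).Point → ℝ)),
          MetricGraph.IsStronglyRecursive D r L ∧
          MetricGraph.IsLocalArray L (MetricGraph.starCenter d ℓ hℓ)
            (MetricGraph.starTangent d ℓ hℓ) (DotArray.redundantClosure P)) ∧
    (∀ (r : ℕ) (ℓ : ℝ) (hℓ : 0 < ℓ) (P : Set (Fin 2 → Fin (r + 1))),
      DotArray.IsPermutationArray P →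
        ∃ (D : MetricGraph.Divisor (MetricGraph.star 2 ℓ hℓ))
          (L : Set ((MetricGraph.star 2 ℓ hℓ).Point → ℝ)),
          MetricGraph.IsStronglyRecursive D r L ∧
          MetricGraph.IsLocalArray L (MetricGraph.starCenter 2 ℓ hℓ)
            (MetricGraph.starTangent 2 ℓ hℓ) (DotArray.redundantClosure P)) := by
  refine ⟨fun d r ℓ hℓ hd _ P hP =>
    MetricGraph.exists_isStronglyRecursive_isLocalArray_star d r ℓ hℓ (by omega) hP,
    fun r ℓ hℓ P hP =>
      MetricGraph.exists_isStronglyRecursive_isLocalArray_star 2 r ℓ hℓ (by omega) hP.isSparse⟩
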